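/- Let $\mathcal C$ be an extensive category with finite products, a stable natural numbers object $\mathbb N$ (for all $f\colon X\to Y$, $g\colon Y\to Y$ there is a unique $h\colon X\times\mathbb N\to Y$ with $h\langle \mathrm{id},o!\rangle=f$ and $h(\mathrm{id}\times s)=g\,h$) and exponentials $X^{\mathbb N}$. Assume that for every object $X$ the functor $X+(-)$ has a final coalgebra $\mathrm{out}\colon DX\to X+DX$, and write $\mathrm{out}^{-1}=[\mathrm{now},\mathrm{later}]$. Then $D$ is the delay monad, a strong monad with unit $\mathrm{now}$, Kleisli lifting $f\mapsto f^\star$, where for $f\colon X\to DY$ the morphism $f^\star\colon DX\to DY$ is the unique one with $\mathrm{out}\,f^\star=[\mathrm{out}\,f,\mathrm{inr}\,f^\star]\,\mathrm{out}$, multiplication $\mu=\mathrm{id}^\star$, and strength $\tau\colon X\times DY\to D(X\times Y)$, the unique morphism with $\mathrm{out}\,\tau=(\mathrm{id}+\tau)\,\mathrm{dstr}\,(\mathrm{id}\times\mathrm{out})$, where $\mathrm{dstr}\colon X\times(Y+Z)\to X\times Y+X\times Z$ is the distributivity isomorphism. Let $\iota_X\colon X\times\mathbb N\to DX$ be given by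 $\iota_X(x,0)=\mathrm{now}\,x$ and $\iota_X(x,n+1)=\mathrm{later}\,\iota_X(x,n)$. Assume that for every $X$ the coequalizer $$D(X\times\mathbb N)\;\underset{D\mathrm{fst}}{\overset{\iota_X^\star}{\rightrightarrows}}\;DX\xrightarrow{\ \rho_X\ }\tilde DX$$ exists and is preserved by all functors $Z\times(-)$. Then $\tilde D$ is a functor and $\rho\colon D\to\tilde D$ is a natural transformation. A $D$-algebra is an object $A$ with a morphism $a\colon DA\to A$; it is a search-algebra if $a\,\mathrm{now}=\mathrm{id}$ and $a\,\mathrm{later}=a$; $DX$ is regarded as the $D$-algebra $(DX,\mu_X)$. In a category with binary coproducts, an Elgot algebra is an object $A$ with an operator sending each $f\colon X\to A+X$ to $f^\sharp\colon X\to A$ such that (Fixpoint) $f^\sharp=[\mathrm{id},f^\sharp]f$; (Uniformity) $(\mathrm{id}+h)f=g\,h$ implies $f^\sharp=g^\sharp h$, for $f\colon X\to A+X$, $g\colon Y\to A+Y$, $h\colon X\to Y$; (Compositionality) $((f^\sharp+\mathrm{id})h)^\sharp=\bigl([(\mathrm{id}+\mathrm{inl})f,\mathrm{inr}\,\mathrm{inr}]\,[\mathrm{inl},h]\bigr)^\sharp\,\mathrm{inr}$,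 for $h\colon Y\to X+Y$, $f\colon X\to A+X$. A morphism of Elgot algebras is an $h\colon A\to B$ with $h f^\sharp=((h+\mathrm{id})f)^\sharp$ for all $f\colon X\to A+X$. For an Elgot algebra $A$ and an object $Z$, the projection $\mathrm{fst}\colon Z\times A\to Z$ is an Elgot algebra in $\mathcal C/Z$, where a morphism $f\colon Y\to Z\times A+Y$ over $Z$, with structure morphism $p\colon Y\to Z$, is iterated to $\langle p,((\mathrm{snd}+\mathrm{id})f)^\sharp\rangle$. A free Elgot algebra $A$ on $X$ with unit $\eta\colon X\to A$ is stable if for every $Z$ the Elgot algebra $\mathrm{fst}\colon Z\times A\to Z$ is free in $\mathcal C/Z$ on $\mathrm{fst}\colon Z\times X\to Z$ with unit $\mathrm{id}\times\eta$. The following conditions are equivalent: (1) for every $X$, the above coequalizer $\rho_X$ is preserved by the functor $D$; (2) every $\tilde DX$ carries a search-algebra structure such that $\rho_X$ is a $D$-algebra morphism; (3) every $\tilde DX$ carries an Elgot algebra structure $(-)^\sharp$ with which $(\tilde DX,\rho_X\,\mathrm{now})$ is a stable free Elgot algebra on $X$, $\rho_X$ is a $D$-algebra morphism from $(DX,\mu_X)$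 to $(\tilde DX,\mathrm{out}^\sharp\colon D\tilde DX\to\tilde DX)$, and $\rho_X=((\rho_X\,\mathrm{now}+\mathrm{id})\,\mathrm{out})^\sharp$; (4) the functor $\tilde D$ extends to a strong monad such that $\rho\colon D\to\tilde D$ is a strong monad morphism, i.e. preserves unit, multiplication and strength. -/

import Mathlib

open CategoryTheory Limits MonoidalCategory CartesianMonoidalCategory

universe v u

namespace DelayQuotient

noncomputable section

/-! ### Elgot algebras -/

section Elgot

variable {C : Type u} [Category.{v} C] [HasBinaryCoproducts C]

/-- An (unguarded) Elgot algebra structure on an object `A`: an iteration operator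
`f ↦ f^♯` sending `f : X ⟶ A + X` to `f^♯ : X ⟶ A`, satisfying the laws
Fixpoint, Uniformity and Compositionality. -/
structure ElgotAlgebra (A : C) where
  iter : ∀ {X : C}, (X ⟶ A ⨿ X) → (X ⟶ A)
  fixpoint : ∀ {X : C} (f : X ⟶ A ⨿ X), iter f = f ≫ coprod.desc (𝟙 A) (iter f)
  uniformity : ∀ {X Y : C} (f : X ⟶ A ⨿ X) (g : Y ⟶ A ⨿ Y) (h : X ⟶ Y),
    f ≫ coprod.map (𝟙 A) h = h ≫ g → iter f = h ≫ iter g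
  compositionality : ∀ {X Y : C} (h : Y ⟶ X ⨿ Y) (f : X ⟶ A ⨿ X),
    iter (h ≫ coprod.map (iter f) (𝟙 Y)) =
      coprod.inr ≫ iter (coprod.desc coprod.inl h ≫
        coprod.desc (f ≫ coprod.map (𝟙 A) coprod.inl) (coprod.inr ≫ coprod.inr))

namespace ElgotAlgebra

/-- Iteration preserving morphisms, i.e. morphisms of Elgot algebras. -/
def IterationPreserving {A B : C} (E : ElgotAlgebra A) (E' : ElgotAlgebra B) (h : A ⟶ B) : Prop :=
  ∀ {X : C} (f : X ⟶ A ⨿ X), E.iter f ≫ h = E'.iter (f ≫ coprod.map h (𝟙 X))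

/-- The Elgot algebra `E` on `A` is free on `X` with unit `η : X ⟶ A`. -/
def IsFree {X A : C} (E : ElgotAlgebra A) (η : X ⟶ A) : Prop :=
  ∀ {B : C} (E' : ElgotAlgebra B) (f : X ⟶ B),
    ∃! h : A ⟶ B, E.IterationPreserving E' h ∧ η ≫ h = f

end ElgotAlgebra

end Elgot

section OverCoproduct

variable {C : Type u} [Category.{v} C] [HasBinaryCoproducts C]

theorem over_inl_desc_left {Z : C} {P Q R : Over Z} {S : C} (f : P ⟶ R) (g : Q ⟶ R)
    (k : R.left ⟶ S) :
    (coprod.inl : P ⟶ P ⨿ Q).left ≫ (coprod.desc f g).left ≫ k = f.left ≫ k := by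
  rw [← Category.assoc, ← Over.comp_left, coprod.inl_desc]

theorem over_inr_desc_left {Z : C} {P Q R : Over Z} {S : C} (f : P ⟶ R) (g : Q ⟶ R)
    (k : R.left ⟶ S) :
    (coprod.inr : Q ⟶ P ⨿ Q).left ≫ (coprod.desc f g).left ≫ k = g.left ≫ k := by
  rw [← Category.assoc, ← Over.comp_left, coprod.inr_desc]

theorem over_inl_map_left {Z : C} {P Q P' Q' : Over Z} {S : C} (f : P ⟶ P') (g : Q ⟶ Q')
    (k : (P' ⨿ Q' : Over Z).left ⟶ S) :
    (coprod.inl : P ⟶ P ⨿ Q).left ≫ (coprod.map f g).left ≫ k =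
      f.left ≫ (coprod.inl : P' ⟶ P' ⨿ Q').left ≫ k := by
  rw [← Category.assoc, ← Over.comp_left, coprod.inl_map, Over.comp_left, Category.assoc]

theorem over_inr_map_left {Z : C} {P Q P' Q' : Over Z} {S : C} (f : P ⟶ P') (g : Q ⟶ Q')
    (k : (P' ⨿ Q' : Over Z).left ⟶ S) :
    (coprod.inr : Q ⟶ P ⨿ Q).left ≫ (coprod.map f g).left ≫ k =
      g.left ≫ (coprod.inr : Q' ⟶ P' ⨿ Q').left ≫ k := by
  rw [← Category.assoc, ← Over.comp_left, coprod.inr_map, Over.comp_left, Category.assoc]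

end OverCoproduct

section Slice

variable {C : Type u} [Category.{v} C] [CartesianMonoidalCategory C] [HasBinaryCoproducts C]

/-- A morphism out of (the domain of) a coproduct in the slice category `C/Z`, given by its
components in `C`. -/
def overDesc {Z : C} {P Q : Over Z} {R : C} (f : P.left ⟶ R) (g : Q.left ⟶ R) :
    (P ⨿ Q : Over Z).left ⟶ R :=
  (coprod.desc (Over.homMk (lift P.hom f) : P ⟶ Over.mk (fst Z R))
    (Over.homMk (lift Q.hom g) : Q ⟶ Over.mk (fst Z R))).left ≫ snd Z R

@[simp]
theorem inl_overDesc {Z : C} {P Q : Over Z} {R : C} (f : P.left ⟶ R) (g : Q.left ⟶ R) :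
    (coprod.inl : P ⟶ P ⨿ Q).left ≫ overDesc f g = f := by
  unfold overDesc
  rw [← Category.assoc, ← Over.comp_left, coprod.inl_desc]
  simp

@[simp]
theorem inr_overDesc {Z : C} {P Q : Over Z} {R : C} (f : P.left ⟶ R) (g : Q.left ⟶ R) :
    (coprod.inr : Q ⟶ P ⨿ Q).left ≫ overDesc f g = g := by
  unfold overDesc
  rw [← Category.assoc, ← Over.comp_left, coprod.inr_desc]
  simp

theorem inl_overDesc_assoc {Z : C} {P Q : Over Z} {R S : C} (f : P.left ⟶ R) (g : Q.left ⟶ R)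
    (k : R ⟶ S) :
    (coprod.inl : P ⟶ P ⨿ Q).left ≫ overDesc f g ≫ k = f ≫ k := by
  rw [← Category.assoc, inl_overDesc]

theorem inr_overDesc_assoc {Z : C} {P Q : Over Z} {R S : C} (f : P.left ⟶ R) (g : Q.left ⟶ R)
    (k : R ⟶ S) :
    (coprod.inr : Q ⟶ P ⨿ Q).left ≫ overDesc f g ≫ k = g ≫ k := by
  rw [← Category.assoc, inr_overDesc]

theorem over_coprod_hom_ext {Z : C} {P Q : Over Z} {R : C} {f g : (P ⨿ Q : Over Z).left ⟶ R}
    (h₁ : (coprod.inl : P ⟶ P ⨿ Q).left ≫ f = (coprod.inl : P ⟶ P ⨿ Q).left ≫ g)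
    (h₂ : (coprod.inr : Q ⟶ P ⨿ Q).left ≫ f = (coprod.inr : Q ⟶ P ⨿ Q).left ≫ g) : f = g := by
  have key : (Over.homMk (lift (P ⨿ Q : Over Z).hom f) : (P ⨿ Q : Over Z) ⟶ Over.mk (fst Z R)) =
      Over.homMk (lift (P ⨿ Q : Over Z).hom g) := by
    apply coprod.hom_ext
    · ext
      simp [h₁]
    · ext
      simp [h₂]
  have := congrArg (fun k => k.left ≫ snd Z R) key
  simpa using this

/-- For an Elgot algebra `A` in `C`, the projection `Z × A ⟶ Z` is an Elgot algebra in `C/Z`: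
a morphism `f : Y ⟶ Z × A + Y` over `Z` is iterated to
`⟨p, ((snd + id) f)^♯⟩ : Y ⟶ Z × A`, where `p : Y ⟶ Z` is the structure morphism of `Y`. -/
def ElgotAlgebra.slice {A : C} (E : ElgotAlgebra A) (Z : C) :
    ElgotAlgebra (Over.mk (fst Z A)) where
  iter {Y} f := Over.homMk
    (lift Y.hom (E.iter (f.left ≫ overDesc (snd Z A ≫ coprod.inl) coprod.inr)))
  fixpoint {Y} f := by
    ext
    apply CartesianMonoidalCategory.hom_ext
    · exact (Over.w (Over.homMk (lift Y.hom _) : Y ⟶ Over.mk (fst Z A))).trans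
        (Over.w (f ≫ coprod.desc (𝟙 _) (Over.homMk _))).symm
    · simp only [Over.comp_left, Category.assoc, Over.homMk_left, lift_snd]
      rw [E.fixpoint]
      simp only [Category.assoc]
      congr 1
      apply over_coprod_hom_ext
      · rw [inl_overDesc_assoc, over_inl_desc_left, Category.assoc, coprod.inl_desc]
        simp
      · rw [inr_overDesc_assoc, over_inr_desc_left, coprod.inr_desc]
        simp only [Over.homMk_left, lift_snd]
        exact (E.fixpoint _).trans (Category.assoc _ _ _)
  uniformity {X Y} f g h w := by
    ext
    apply CartesianMonoidalCategory.hom_ext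
    · simp
    · simp only [Over.comp_left, Category.assoc, Over.homMk_left, lift_snd]
      apply E.uniformity
      rw [← Category.assoc, ← Over.comp_left, ← w, Over.comp_left, Category.assoc, Category.assoc]
      congr 1
      apply over_coprod_hom_ext
      · rw [inl_overDesc_assoc, over_inl_map_left, inl_overDesc]
        simp
      · rw [inr_overDesc_assoc, over_inr_map_left, inr_overDesc]
        simp
  compositionality {X Y} h f := by
    ext
    apply CartesianMonoidalCategory.hom_ext
    · simp
    · simp only [Over.comp_left, Category.assoc, Over.homMk_left, lift_snd]
      set k := f.left ≫ overDesc (snd Z A ≫ coprod.inl) coprod.inr with hk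
      set l : Y.left ⟶ X.left ⨿ Y.left := h.left ≫ overDesc coprod.inl coprod.inr with hl
      have e₁ : h.left ≫ (coprod.map (Over.homMk (lift X.hom (E.iter k)) : X ⟶ Over.mk (fst Z A))
          (𝟙 Y)).left ≫ overDesc (snd Z A ≫ coprod.inl) coprod.inr =
          l ≫ coprod.map (E.iter k) (𝟙 Y.left) := by
        rw [hl, Category.assoc]
        congr 1
        apply over_coprod_hom_ext
        · rw [over_inl_map_left, inl_overDesc, inl_overDesc_assoc]
          simp
        · rw [over_inr_map_left, inr_overDesc, inr_overDesc_assoc]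
          simp
      rw [e₁, E.compositionality]
      rw [← inr_overDesc_assoc (P := X) (Q := Y) coprod.inl coprod.inr]
      congr 1
      symm
      apply E.uniformity
      simp only [Category.assoc]
      have aux : ∀ q : (X ⨿ Y : Over Z).left ⟶ X.left ⨿ Y.left,
          q = overDesc coprod.inl coprod.inr →
          ((coprod.desc (f ≫ coprod.map (𝟙 _) coprod.inl) (coprod.inr ≫ coprod.inr) :
            X ⨿ Y ⟶ Over.mk (fst Z A) ⨿ (X ⨿ Y)).left ≫
              overDesc (snd Z A ≫ coprod.inl) coprod.inr) ≫ coprod.map (𝟙 A) q =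
            overDesc coprod.inl coprod.inr ≫
              coprod.desc (k ≫ coprod.map (𝟙 A) coprod.inl) (coprod.inr ≫ coprod.inr) := by
        rintro q rfl
        apply over_coprod_hom_ext
        · rw [inl_overDesc_assoc, Category.assoc, over_inl_desc_left, coprod.inl_desc, hk,
            Over.comp_left, Category.assoc, Category.assoc]
          congr 1
          apply over_coprod_hom_ext
          · rw [over_inl_map_left, inl_overDesc_assoc, inl_overDesc_assoc]
            simp
          · rw [over_inr_map_left, inr_overDesc_assoc, inr_overDesc_assoc, coprod.inr_map,
              coprod.inr_map, ← Category.assoc, inl_overDesc]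
        · rw [inr_overDesc_assoc, Category.assoc, over_inr_desc_left, coprod.inr_desc,
            Over.comp_left, Category.assoc, inr_overDesc_assoc, coprod.inr_map,
            ← Category.assoc, inr_overDesc]
      have aux' := aux _ rfl
      simp only [Category.assoc] at aux'
      rw [aux', ← Category.assoc, ← Category.assoc]
      congr 1
      apply over_coprod_hom_ext
      · rw [over_inl_desc_left, ← Category.assoc, inl_overDesc, coprod.inl_desc]
      · rw [over_inr_desc_left, ← Category.assoc, inr_overDesc, coprod.inr_desc]

/-- The Elgot algebra `E` on `A` is a stable free Elgot algebra on `X` with unit `η : X ⟶ A`: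
it is free, and for every `Z`, the projection `Z × A ⟶ Z` is a free Elgot algebra
in the slice category `C/Z` on the projection `Z × X ⟶ Z`, with unit `id × η`. -/
def ElgotAlgebra.IsStableFree {X A : C} (E : ElgotAlgebra A) (η : X ⟶ A) : Prop :=
  E.IsFree η ∧ ∀ Z : C,
    (E.slice Z).IsFree (Over.homMk (Z ◁ η) : Over.mk (fst Z X) ⟶ Over.mk (fst Z A))

end Slice

/-! ### Strong monads -/

section StrongMonads

variable {C : Type u} [Category.{v} C] [CartesianMonoidalCategory C]

/-- The structure of a strong monad on an endofunctor `T`, with respect to the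
Cartesian monoidal structure. -/
structure StrongMonadStr (T : C ⥤ C) where
  η : ∀ X : C, X ⟶ T.obj X
  μ : ∀ X : C, T.obj (T.obj X) ⟶ T.obj X
  τ : ∀ X Y : C, X ⊗ T.obj Y ⟶ T.obj (X ⊗ Y)
  η_naturality : ∀ {X Y : C} (f : X ⟶ Y), f ≫ η Y = η X ≫ T.map f
  μ_naturality : ∀ {X Y : C} (f : X ⟶ Y), T.map (T.map f) ≫ μ Y = μ X ≫ T.map f
  τ_naturality : ∀ {X X' Y Y' : C} (f : X ⟶ X') (g : Y ⟶ Y'),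
    (f ⊗ₘ T.map g) ≫ τ X' Y' = τ X Y ≫ T.map (f ⊗ₘ g)
  assoc : ∀ X : C, T.map (μ X) ≫ μ X = μ (T.obj X) ≫ μ X
  left_unit : ∀ X : C, η (T.obj X) ≫ μ X = 𝟙 (T.obj X)
  right_unit : ∀ X : C, T.map (η X) ≫ μ X = 𝟙 (T.obj X)
  τ_snd : ∀ X : C, ∀ Y : C, τ X Y ≫ T.map (snd X Y) = snd X (T.obj Y)
  τ_assoc : ∀ X Y Z : C, τ (X ⊗ Y) Z ≫ T.map (α_ X Y Z).hom =
    (α_ X Y (T.obj Z)).hom ≫ X ◁ τ Y Z ≫ τ X (Y ⊗ Z)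
  τ_η : ∀ X Y : C, X ◁ η Y ≫ τ X Y = η (X ⊗ Y)
  τ_μ : ∀ X Y : C, X ◁ μ Y ≫ τ X Y = τ X (T.obj Y) ≫ T.map (τ X Y) ≫ μ (X ⊗ Y)

/-- A natural transformation is a strong monad morphism if it preserves unit, multiplication
and strength. -/
structure IsStrongMonadMorphism {S T : C ⥤ C} (MS : StrongMonadStr S) (MT : StrongMonadStr T)
    (φ : S ⟶ T) : Prop where
  unit : ∀ X : C, MS.η X ≫ φ.app X = MT.η X
  mult : ∀ X : C, MS.μ X ≫ φ.app X = S.map (φ.app X) ≫ φ.app (T.obj X) ≫ MT.μ X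
  strength : ∀ X Y : C, MS.τ X Y ≫ φ.app (X ⊗ Y) = X ◁ φ.app Y ≫ MT.τ X Y

end StrongMonads

/-! ### Natural numbers -/

/-- A stable natural numbers object. -/
structure StableNNO (C : Type u) [Category.{v} C] [CartesianMonoidalCategory C] where
  N : C
  zero : 𝟙_ C ⟶ N
  succ : N ⟶ N
  existsUnique_init : ∀ {X Y : C} (f : X ⟶ Y) (g : Y ⟶ Y), ∃! h : X ⊗ N ⟶ Y,
    lift (𝟙 X) (toUnit X ≫ zero) ≫ h = f ∧ (X ◁ succ) ≫ h = h ≫ g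

namespace StableNNO

variable {C : Type u} [Category.{v} C] [CartesianMonoidalCategory C] (𝒩 : StableNNO C)

/-- Definition by iteration: `init f g (x, 0) = f x` and `init f g (x, n + 1) = g (init f g (x, n))`. -/
def init {X Y : C} (f : X ⟶ Y) (g : Y ⟶ Y) : X ⊗ 𝒩.N ⟶ Y :=
  (𝒩.existsUnique_init f g).choose

theorem zero_init {X Y : C} (f : X ⟶ Y) (g : Y ⟶ Y) :
    lift (𝟙 X) (toUnit X ≫ 𝒩.zero) ≫ 𝒩.init f g = f :=
  (𝒩.existsUnique_init f g).choose_spec.1.1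

theorem succ_init {X Y : C} (f : X ⟶ Y) (g : Y ⟶ Y) :
    (X ◁ 𝒩.succ) ≫ 𝒩.init f g = 𝒩.init f g ≫ g :=
  (𝒩.existsUnique_init f g).choose_spec.1.2

theorem init_unique {X Y : C} {f : X ⟶ Y} {g : Y ⟶ Y} {h : X ⊗ 𝒩.N ⟶ Y}
    (h₀ : lift (𝟙 X) (toUnit X ≫ 𝒩.zero) ≫ h = f) (h₁ : (X ◁ 𝒩.succ) ≫ h = h ≫ g) :
    h = 𝒩.init f g :=
  (𝒩.existsUnique_init f g).choose_spec.2 h ⟨h₀, h₁⟩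

end StableNNO

/-! ### Distributivity of products over coproducts -/

section Distributivity

variable {C : Type u} [Category.{v} C] [CartesianMonoidalCategory C] [FinitaryExtensive C]

instance isIso_dist (X Y Z : C) :
    IsIso (coprod.desc (X ◁ coprod.inl) (X ◁ coprod.inr) : (X ⊗ Y) ⨿ (X ⊗ Z) ⟶ X ⊗ (Y ⨿ Z)) := by
  have H := (BinaryCofan.isVanKampen_iff _).1
    (FinitaryExtensive.van_kampen' _ (coprodIsCoprod Y Z))
    (BinaryCofan.mk (X ◁ (coprod.inl : Y ⟶ Y ⨿ Z)) (X ◁ (coprod.inr : Z ⟶ Y ⨿ Z)))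
    (snd X Y) (snd X Z) (snd X (Y ⨿ Z)) (whiskerLeft_snd _ _).symm (whiskerLeft_snd _ _).symm
  have pb : ∀ {W : C} (k : W ⟶ Y ⨿ Z),
      IsPullback (X ◁ k) (snd X W) (snd X (Y ⨿ Z)) k := by
    intro W k
    refine ⟨⟨by simp⟩, ⟨PullbackCone.IsLimit.mk _ (fun s => lift (s.fst ≫ fst _ _) s.snd)
      ?_ ?_ ?_⟩⟩
    · intro s
      ext
      · simp
      · simp [s.condition]
    · intro s
      simp
    · intro s m h₁ h₂
      ext
      · simp [← h₁]
      · simp [← h₂]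
  obtain ⟨hc⟩ := H.2 ⟨pb _, pb _⟩
  have : coprod.desc (X ◁ coprod.inl) (X ◁ coprod.inr) =
      ((coprodIsCoprod (X ⊗ Y) (X ⊗ Z)).coconePointUniqueUpToIso hc).hom := by
    apply coprod.hom_ext
    · rw [coprod.inl_desc]
      exact ((coprodIsCoprod (X ⊗ Y) (X ⊗ Z)).comp_coconePointUniqueUpToIso_hom hc
        ⟨WalkingPair.left⟩).symm
    · rw [coprod.inr_desc]
      exact ((coprodIsCoprod (X ⊗ Y) (X ⊗ Z)).comp_coconePointUniqueUpToIso_hom hc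
        ⟨WalkingPair.right⟩).symm
  rw [this]
  exact Iso.isIso_hom _

/-- The inverse of the canonical isomorphism `X × Y + X × Z ⟶ X × (Y + Z)`. -/
def dstr (X Y Z : C) : X ⊗ (Y ⨿ Z) ⟶ (X ⊗ Y) ⨿ (X ⊗ Z) :=
  inv (coprod.desc (X ◁ coprod.inl) (X ◁ coprod.inr))

@[simp]
theorem inl_dstr (X Y Z : C) : X ◁ (coprod.inl : Y ⟶ Y ⨿ Z) ≫ dstr X Y Z = coprod.inl := by
  rw [dstr, IsIso.comp_inv_eq, coprod.inl_desc]

@[simp]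
theorem inr_dstr (X Y Z : C) : X ◁ (coprod.inr : Z ⟶ Y ⨿ Z) ≫ dstr X Y Z = coprod.inr := by
  rw [dstr, IsIso.comp_inv_eq, coprod.inr_desc]

end Distributivity

/-! ### The delay monad -/

/-- Existence of the final coalgebras `D X = ν γ. X + γ` of the functors `X + (-)`. -/
class HasDelay (C : Type u) [Category.{v} C] [HasBinaryCoproducts C] : Prop where
  hasFinalCoalgebra : ∀ X : C, HasTerminal (Endofunctor.Coalgebra (coprod.functor.obj X))

attribute [instance] HasDelay.hasFinalCoalgebra

section Delay

variable {C : Type u} [Category.{v} C] [HasBinaryCoproducts C] [HasDelay C]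

attribute [local simp] coprod.inl_desc coprod.inr_desc coprod.inl_desc_assoc coprod.inr_desc_assoc

/-- The carrier `D X` of the final coalgebra of `X + (-)`. -/
def D (X : C) : C := (⊤_ (Endofunctor.Coalgebra (coprod.functor.obj X))).V

/-- The final coalgebra structure. -/
def out (X : C) : D X ⟶ X ⨿ D X := (⊤_ (Endofunctor.Coalgebra (coprod.functor.obj X))).str

/-- Coiteration: the unique coalgebra morphism into the final coalgebra. -/
def coit {X Y : C} (f : Y ⟶ X ⨿ Y) : Y ⟶ D X :=
  (terminal.from (⟨Y, f⟩ : Endofunctor.Coalgebra (coprod.functor.obj X))).f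

theorem coit_out {X Y : C} (f : Y ⟶ X ⨿ Y) :
    coit f ≫ out X = f ≫ coprod.map (𝟙 X) (coit f) :=
  (terminal.from (⟨Y, f⟩ : Endofunctor.Coalgebra (coprod.functor.obj X))).h.symm

theorem coit_unique {X Y : C} {f : Y ⟶ X ⨿ Y} {g : Y ⟶ D X}
    (h : g ≫ out X = f ≫ coprod.map (𝟙 X) g) : g = coit f :=
  congrArg (fun k : (⟨Y, f⟩ : Endofunctor.Coalgebra (coprod.functor.obj X)) ⟶
      ⊤_ (Endofunctor.Coalgebra (coprod.functor.obj X)) => k.f)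
    (terminal.hom_ext (Endofunctor.Coalgebra.Hom.mk g h.symm) (terminal.from _))

instance isIso_out (X : C) : IsIso (out X) :=
  Endofunctor.Coalgebra.Terminal.str_isIso terminalIsTerminal

/-- `out⁻¹ = [now, later]`. -/
def now (X : C) : X ⟶ D X := coprod.inl ≫ inv (out X)

/-- `out⁻¹ = [now, later]`. -/
def later (X : C) : D X ⟶ D X := coprod.inr ≫ inv (out X)

theorem now_out (X : C) : now X ≫ out X = coprod.inl := by simp [now]

theorem later_out (X : C) : later X ≫ out X = coprod.inr := by simp [later]

/-- The corecursive system of which Kleisli lifting is the solution. -/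
def liftSystem {P X Y : C} (h : P ⟶ X ⨿ P) (f : X ⟶ D Y) : P ⨿ D Y ⟶ Y ⨿ (P ⨿ D Y) :=
  coprod.desc
    (h ≫ coprod.desc (f ≫ out Y ≫ coprod.map (𝟙 Y) coprod.inr) (coprod.inl ≫ coprod.inr))
    (out Y ≫ coprod.map (𝟙 Y) coprod.inr)

theorem eq_coit_liftSystem {P X Y : C} {h : P ⟶ X ⨿ P} {f : X ⟶ D Y} {m : P ⟶ D Y}
    (hm : m ≫ out Y = h ≫ coprod.desc (f ≫ out Y) (m ≫ coprod.inr)) :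
    m = coprod.inl ≫ coit (liftSystem h f) := by
  have : coprod.desc m (𝟙 (D Y)) = coit (liftSystem h f) := by
    apply coit_unique
    apply coprod.hom_ext
    · rw [liftSystem, ← Category.assoc, coprod.inl_desc, hm, ← Category.assoc, coprod.inl_desc,
        Category.assoc]
      congr 1
      apply coprod.hom_ext
      · simp
      · simp
    · simp [liftSystem]
  rw [← this, coprod.inl_desc]

/-- Kleisli lifting of the delay monad. -/
def kleisli {X Y : C} (f : X ⟶ D Y) : D X ⟶ D Y := coprod.inl ≫ coit (liftSystem (out X) f)

theorem kleisli_out {X Y : C} (f : X ⟶ D Y) :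
    kleisli f ≫ out Y = out X ≫ coprod.desc (f ≫ out Y) (kleisli f ≫ coprod.inr) := by
  have h : coprod.inr ≫ coit (liftSystem (out X) f) = 𝟙 (D Y) := by
    have e : coit (out Y) = 𝟙 (D Y) := (coit_unique (by simp)).symm
    rw [← e]
    apply coit_unique
    rw [Category.assoc, coit_out, liftSystem, ← Category.assoc, coprod.inr_desc]
    simp
  rw [kleisli, Category.assoc, coit_out]
  conv_lhs => rw [liftSystem, ← Category.assoc, coprod.inl_desc, Category.assoc]
  congr 1
  apply coprod.hom_ext
  · rw [← liftSystem]
    simp [h]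
  · rw [← liftSystem]
    simp

theorem kleisli_unique {X Y : C} {f : X ⟶ D Y} {g : D X ⟶ D Y}
    (h : g ≫ out Y = out X ≫ coprod.desc (f ≫ out Y) (g ≫ coprod.inr)) : g = kleisli f :=
  eq_coit_liftSystem h

theorem solution_unique {P X Y : C} {h : P ⟶ X ⨿ P} {f : X ⟶ D Y} {m m' : P ⟶ D Y}
    (hm : m ≫ out Y = h ≫ coprod.desc (f ≫ out Y) (m ≫ coprod.inr))
    (hm' : m' ≫ out Y = h ≫ coprod.desc (f ≫ out Y) (m' ≫ coprod.inr)) : m = m' :=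
  (eq_coit_liftSystem hm).trans (eq_coit_liftSystem hm').symm

theorem kleisli_now (X : C) : kleisli (now X) = 𝟙 (D X) := by
  symm
  apply kleisli_unique
  simp [now_out]

theorem now_kleisli {X Y : C} (f : X ⟶ D Y) : now X ≫ kleisli f = f := by
  rw [← cancel_mono (out Y), Category.assoc, kleisli_out, ← Category.assoc, now_out,
    coprod.inl_desc]

theorem later_kleisli {X Y : C} (f : X ⟶ D Y) : later X ≫ kleisli f = kleisli f ≫ later Y := by
  rw [← cancel_mono (out Y), Category.assoc, kleisli_out, ← Category.assoc, later_out,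
    coprod.inr_desc, Category.assoc, later_out]

theorem kleisli_kleisli {X Y Z : C} (f : X ⟶ D Y) (g : Y ⟶ D Z) :
    kleisli f ≫ kleisli g = kleisli (f ≫ kleisli g) := by
  apply kleisli_unique
  rw [Category.assoc, kleisli_out, ← Category.assoc, kleisli_out, Category.assoc]
  congr 1
  apply coprod.hom_ext
  · simp [kleisli_out]
  · simp

/-- The action of the delay monad on morphisms. -/
def mapD {X Y : C} (f : X ⟶ Y) : D X ⟶ D Y := kleisli (f ≫ now Y)

/-- The multiplication of the delay monad. -/
def mult (X : C) : D (D X) ⟶ D X := kleisli (𝟙 (D X))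

theorem mapD_kleisli {X Y Z : C} (f : X ⟶ Y) (g : Y ⟶ D Z) : mapD f ≫ kleisli g = kleisli (f ≫ g) := by
  rw [mapD, kleisli_kleisli, Category.assoc, now_kleisli]

theorem kleisli_mapD {X Y Z : C} (f : X ⟶ D Y) (g : Y ⟶ Z) : kleisli f ≫ mapD g = kleisli (f ≫ mapD g) :=
  kleisli_kleisli _ _

theorem mapD_id (X : C) : mapD (𝟙 X) = 𝟙 (D X) := by
  rw [mapD, Category.id_comp, kleisli_now]

theorem mapD_comp {X Y Z : C} (f : X ⟶ Y) (g : Y ⟶ Z) : mapD (f ≫ g) = mapD f ≫ mapD g := by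
  rw [mapD, Category.assoc]
  exact (mapD_kleisli f (g ≫ now Z)).symm

theorem now_mapD {X Y : C} (f : X ⟶ Y) : now X ≫ mapD f = f ≫ now Y := now_kleisli _

theorem later_mapD {X Y : C} (f : X ⟶ Y) : later X ≫ mapD f = mapD f ≫ later Y := later_kleisli _

theorem now_mult (X : C) : now (D X) ≫ mult X = 𝟙 (D X) := now_kleisli _

theorem later_mult (X : C) : later (D X) ≫ mult X = mult X ≫ later X := later_kleisli _

theorem mapD_mult {X Y : C} (f : X ⟶ D Y) : mapD f ≫ mult Y = kleisli f := by
  rw [mult, mapD_kleisli, Category.comp_id]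

variable (C) in
/-- The functor part of the delay monad. -/
abbrev delayFunctor : C ⥤ C where
  obj X := D X
  map f := mapD f
  map_id X := mapD_id X
  map_comp f g := mapD_comp f g

end Delay

section DelayStrength

variable {C : Type u} [Category.{v} C] [CartesianMonoidalCategory C] [FinitaryExtensive C]
  [HasDelay C]

attribute [local simp] coprod.inl_desc coprod.inr_desc coprod.inl_desc_assoc coprod.inr_desc_assoc

/-- The strength of the delay monad. -/
def strength (X Y : C) : X ⊗ D Y ⟶ D (X ⊗ Y) := coit (X ◁ out Y ≫ dstr X Y (D Y))

theorem now_strength (X Y : C) : X ◁ now Y ≫ strength X Y = now (X ⊗ Y) := by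
  rw [← cancel_mono (out _), Category.assoc, now_out, strength, coit_out, Category.assoc,
    ← MonoidalCategory.whiskerLeft_comp_assoc, now_out, ← Category.assoc, inl_dstr,
    coprod.inl_map, Category.id_comp]

theorem later_strength (X Y : C) :
    X ◁ later Y ≫ strength X Y = strength X Y ≫ later (X ⊗ Y) := by
  rw [← cancel_mono (out _), Category.assoc, Category.assoc, later_out, strength, coit_out,
    Category.assoc, ← MonoidalCategory.whiskerLeft_comp_assoc, later_out, ← Category.assoc,
    inr_dstr, coprod.inr_map]

theorem prod_delay_hom_ext {X Y Z : C} {m m' : X ⊗ D Y ⟶ Z}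
    (h₀ : X ◁ now Y ≫ m = X ◁ now Y ≫ m') (h₁ : X ◁ later Y ≫ m = X ◁ later Y ≫ m') :
    m = m' := by
  rw [← cancel_epi (X ◁ inv (out Y)),
    ← cancel_epi (coprod.desc (X ◁ coprod.inl) (X ◁ coprod.inr) :
      (X ⊗ Y) ⨿ (X ⊗ D Y) ⟶ X ⊗ (Y ⨿ D Y))]
  apply coprod.hom_ext
  · simpa [now] using h₀
  · simpa [later] using h₁

theorem prod_delay_corec_ext {X Y Z : C} {m m' : X ⊗ D Y ⟶ D Z}
    (h₀ : X ◁ now Y ≫ m = X ◁ now Y ≫ m') (h₁ : X ◁ later Y ≫ m = m ≫ later Z)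
    (h₁' : X ◁ later Y ≫ m' = m' ≫ later Z) : m = m' := by
  have key : ∀ k : X ⊗ D Y ⟶ D Z, X ◁ now Y ≫ k = X ◁ now Y ≫ m →
      X ◁ later Y ≫ k = k ≫ later Z →
      k ≫ out Z = (X ◁ out Y ≫ dstr X Y (D Y)) ≫
        coprod.desc ((X ◁ now Y ≫ m) ≫ out Z) (k ≫ coprod.inr) := by
    intro k hk₀ hk₁
    apply prod_delay_hom_ext
    · rw [← Category.assoc, hk₀, Category.assoc, Category.assoc (X ◁ out Y),
        ← MonoidalCategory.whiskerLeft_comp_assoc, now_out, ← Category.assoc (X ◁ coprod.inl),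
        inl_dstr, coprod.inl_desc]
    · rw [← Category.assoc, hk₁, Category.assoc, later_out, Category.assoc (X ◁ out Y),
        ← MonoidalCategory.whiskerLeft_comp_assoc, later_out, ← Category.assoc (X ◁ coprod.inr),
        inr_dstr, coprod.inr_desc]
  exact solution_unique (key m rfl h₁) (key m' h₀.symm h₁')

theorem strength_naturality {X X' Y Y' : C} (f : X ⟶ X') (g : Y ⟶ Y') :
    (f ⊗ₘ mapD g) ≫ strength X' Y' = strength X Y ≫ mapD (f ⊗ₘ g) := by
  have e : ∀ {A B B' : C} (a : A ⟶ B) (b : B ⟶ B'), X ◁ a ≫ (f ⊗ₘ b) = (f ⊗ₘ (a ≫ b)) := by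
    intros
    ext <;> simp
  have e' : ∀ {A B B' : C} (a : A ⟶ B) (b : B ⟶ B'), (f ⊗ₘ (a ≫ b)) = (f ⊗ₘ a) ≫ X' ◁ b := by
    intros
    ext <;> simp
  apply prod_delay_corec_ext
  · rw [← Category.assoc, e, now_mapD, e', Category.assoc, now_strength, ← Category.assoc,
      now_strength, now_mapD]
  · rw [← Category.assoc, e, later_mapD, e', Category.assoc, later_strength, Category.assoc]
  · rw [← Category.assoc, later_strength, Category.assoc, later_mapD, Category.assoc]

theorem strength_snd (X Y : C) : strength X Y ≫ mapD (snd X Y) = snd X (D Y) := by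
  apply prod_delay_corec_ext
  · rw [← Category.assoc, now_strength, now_mapD, whiskerLeft_snd]
  · rw [← Category.assoc, later_strength, Category.assoc, later_mapD, Category.assoc]
  · rw [whiskerLeft_snd]

theorem strength_assoc (X Y Z : C) :
    strength (X ⊗ Y) Z ≫ mapD (α_ X Y Z).hom =
      (α_ X Y (D Z)).hom ≫ X ◁ strength Y Z ≫ strength X (Y ⊗ Z) := by
  have e : ∀ {A B : C} (a : A ⟶ B), (X ⊗ Y) ◁ a ≫ (α_ X Y B).hom =
      (α_ X Y A).hom ≫ X ◁ (Y ◁ a) := by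
    intros
    simp
  apply prod_delay_corec_ext
  · rw [← Category.assoc, now_strength, now_mapD, ← Category.assoc, e, Category.assoc,
      ← MonoidalCategory.whiskerLeft_comp_assoc, now_strength, now_strength]
  · rw [← Category.assoc, later_strength, Category.assoc, later_mapD, Category.assoc]
  · rw [← Category.assoc, e, Category.assoc, ← MonoidalCategory.whiskerLeft_comp_assoc,
      later_strength, MonoidalCategory.whiskerLeft_comp_assoc, later_strength, Category.assoc,
      Category.assoc]

theorem strength_mult (X Y : C) :
    X ◁ mult Y ≫ strength X Y = strength X (D Y) ≫ mapD (strength X Y) ≫ mult (X ⊗ Y) := by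
  apply prod_delay_corec_ext
  · rw [← MonoidalCategory.whiskerLeft_comp_assoc, now_mult, MonoidalCategory.whiskerLeft_id,
      Category.id_comp, ← Category.assoc, now_strength, mapD_mult, now_kleisli]
  · rw [← MonoidalCategory.whiskerLeft_comp_assoc, later_mult,
      MonoidalCategory.whiskerLeft_comp_assoc, later_strength, Category.assoc]
  · rw [mapD_mult, ← Category.assoc, later_strength, Category.assoc, later_kleisli, Category.assoc]

variable (C) in
/-- The delay monad as a strong monad. -/
def delayStrongMonad : StrongMonadStr (delayFunctor C) where
  η := now
  μ := mult
  τ := strength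
  η_naturality f := (now_mapD f).symm
  μ_naturality f := by
    change mapD (mapD f) ≫ mult _ = mult _ ≫ mapD f
    rw [mapD_mult, mult, kleisli_mapD, Category.id_comp]
  τ_naturality f g := strength_naturality f g
  assoc X := by
    change mapD (mult X) ≫ mult X = mult (D X) ≫ mult X
    rw [mapD_mult, mult, mult, kleisli_kleisli, Category.id_comp]
  left_unit X := now_mult X
  right_unit X := (mapD_mult (now X)).trans (kleisli_now X)
  τ_snd X Y := strength_snd X Y
  τ_assoc X Y Z := strength_assoc X Y Z
  τ_η X Y := now_strength X Y
  τ_μ X Y := strength_mult X Y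

end DelayStrength

/-! ### The quotient of the delay monad -/

section Quotient

variable {C : Type u} [Category.{v} C] [CartesianMonoidalCategory C] [HasBinaryCoproducts C]
  [HasDelay C] (𝒩 : StableNNO C)

/-- The morphism `ι : X × ℕ ⟶ D X` with `ι (x, 0) = now x` and `ι (x, n + 1) = later (ι (x, n))`. -/
def iota (X : C) : X ⊗ 𝒩.N ⟶ D X := 𝒩.init (now X) (later X)

theorem iota_naturality {X Y : C} (f : X ⟶ Y) :
    iota 𝒩 X ≫ mapD f = f ▷ 𝒩.N ≫ iota 𝒩 Y := by
  trans 𝒩.init (f ≫ now Y) (later Y)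
  · apply 𝒩.init_unique
    · rw [← Category.assoc, iota, 𝒩.zero_init, now_mapD]
    · rw [← Category.assoc, iota, 𝒩.succ_init, Category.assoc, later_mapD, Category.assoc]
  · symm
    apply 𝒩.init_unique
    · have : lift (𝟙 X) (toUnit X ≫ 𝒩.zero) ≫ f ▷ 𝒩.N =
          f ≫ lift (𝟙 Y) (toUnit Y ≫ 𝒩.zero) := by
        ext <;> simp
      rw [← Category.assoc, this, Category.assoc, iota, 𝒩.zero_init]
    · have : X ◁ 𝒩.succ ≫ f ▷ 𝒩.N = f ▷ 𝒩.N ≫ Y ◁ 𝒩.succ := by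
        ext <;> simp
      rw [← Category.assoc, this, Category.assoc, iota, 𝒩.succ_init, Category.assoc]

/-- Kleisli lifting `ι^⋆ : D (X × ℕ) ⟶ D X` of `ι`. -/
def iotaStar (X : C) : D (X ⊗ 𝒩.N) ⟶ D X := kleisli (iota 𝒩 X)

/-- The morphism `D fst : D (X × ℕ) ⟶ D X`. -/
def mapFst (X : C) : D (X ⊗ 𝒩.N) ⟶ D X := (delayFunctor C).map (fst X 𝒩.N)

/-- The coequalizers of `ι^⋆` and `D fst` exist. -/
class HasDelayQuotient : Prop where
  hasCoequalizer : ∀ X : C, HasCoequalizer (iotaStar 𝒩 X) (mapFst 𝒩 X)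

attribute [instance] HasDelayQuotient.hasCoequalizer

variable [HasDelayQuotient 𝒩]

/-- The quotient of `D X`, i.e. the coequalizer of `ι^⋆` and `D fst`. -/
def Dtilde (X : C) : C := coequalizer (iotaStar 𝒩 X) (mapFst 𝒩 X)

/-- The quotient morphism `ρ : D X ⟶ Dtilde X`. -/
def rho (X : C) : D X ⟶ Dtilde 𝒩 X := coequalizer.π (iotaStar 𝒩 X) (mapFst 𝒩 X)

theorem rho_condition (X : C) : iotaStar 𝒩 X ≫ rho 𝒩 X = mapFst 𝒩 X ≫ rho 𝒩 X :=
  coequalizer.condition _ _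

theorem dtilde_hom_ext {X Z : C} {f g : Dtilde 𝒩 X ⟶ Z} (h : rho 𝒩 X ≫ f = rho 𝒩 X ≫ g) : f = g :=
  coequalizer.hom_ext h

/-- The action of the quotient on morphisms, determined by naturality of `ρ`. -/
def dtildeMap {X Y : C} (f : X ⟶ Y) : Dtilde 𝒩 X ⟶ Dtilde 𝒩 Y :=
  coequalizer.desc (mapD f ≫ rho 𝒩 Y) (by
    have h₁ : iotaStar 𝒩 X ≫ mapD f = mapD (f ▷ 𝒩.N) ≫ iotaStar 𝒩 Y := by
      rw [iotaStar, kleisli_mapD, iotaStar, mapD_kleisli, iota_naturality]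
    have h₂ : mapFst 𝒩 X ≫ mapD f = mapD (f ▷ 𝒩.N) ≫ mapFst 𝒩 Y := by
      change mapD _ ≫ mapD f = mapD _ ≫ mapD _
      rw [← mapD_comp, ← mapD_comp, whiskerRight_fst]
    rw [← Category.assoc, ← Category.assoc, h₁, h₂, Category.assoc, Category.assoc, rho_condition])

theorem rho_dtildeMap {X Y : C} (f : X ⟶ Y) : rho 𝒩 X ≫ dtildeMap 𝒩 f = mapD f ≫ rho 𝒩 Y :=
  coequalizer.π_desc _ _

/-- The quotient as a functor. -/
abbrev dtildeFunctor : C ⥤ C where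
  obj X := Dtilde 𝒩 X
  map f := dtildeMap 𝒩 f
  map_id X := by
    apply dtilde_hom_ext
    rw [rho_dtildeMap, mapD_id, Category.id_comp, Category.comp_id]
  map_comp f g := by
    apply dtilde_hom_ext
    rw [rho_dtildeMap, mapD_comp, Category.assoc, ← Category.assoc (rho _ _), rho_dtildeMap,
      Category.assoc, rho_dtildeMap]

/-- The quotient morphisms form a natural transformation. -/
def rhoNat : delayFunctor C ⟶ dtildeFunctor 𝒩 where
  app X := rho 𝒩 X
  naturality _ _ f := (rho_dtildeMap 𝒩 f).symm

end Quotient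

section SearchAlgebra

variable {C : Type u} [Category.{v} C] [HasBinaryCoproducts C] [HasDelay C]

/-- A `D`-algebra `a : D A ⟶ A` is a search-algebra if `a now = id` and `a later = a`. -/
structure IsSearchAlgebra {A : C} (a : D A ⟶ A) : Prop where
  now : now A ≫ a = 𝟙 A
  later : later A ≫ a = a

/-- `h` is a morphism of `D`-algebras from `(A, a)` to `(B, b)`. -/
def IsDAlgebraMorphism {A B : C} (a : D A ⟶ A) (b : D B ⟶ B) (h : A ⟶ B) : Prop :=
  a ≫ h = (delayFunctor C).map h ≫ b

end SearchAlgebra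

end

end DelayQuotient

namespace DelayQuotient

noncomputable section

/-! ### Corecursion principles for the delay monad -/

section DelayBasics

variable {C : Type u} [Category.{v} C] [HasBinaryCoproducts C] [HasDelay C]

attribute [local simp] coprod.inl_desc coprod.inr_desc coprod.inl_desc_assoc coprod.inr_desc_assoc

/-! Condition (2) is the hub, to which each other condition is shown equivalent. The basic
observation: a delayed element `d` of a search-algebra `(A, a)` is determined by its timing and its
value `a d`, since overwriting the eventual outcome of `d` by `a d` gives back `d`
(`lift_delayConst_of_isSearchAlgebra`). So `⟨a, id⟩` is a section of the overwriting map `A × D A ⟶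
D A`, which is natural in the first factor. As products preserve the coequalizer `ρ`, the morphism
`ρ × id` is again a coequalizer, and the section transfers what is needed to `D ρ`.

(2) ⇒ (1): uniqueness of factorizations through `D ρ` is immediate from the section. For existence,
let `u` on `D (D X)` coequalize `D ι^⋆` and `D (D fst)`. After overwriting, `u` descends along `ρ ×
id`; restricting along `⟨α, id⟩` leaves `u` precomposed with the map that overwrites the outcome of
`d : D (D X)` by the flattened `μ d`. That map is not the identity, but `u` cannot tell: tag the
outcome with the number `n` of outer steps; forgetting the tag gives the identity, while adding `n`
steps to the inner computation gives `μ d` (`annotate_mapFst`, `annotate_iotaStar`).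

(2) ⇒ (4): by the same section, `Z × D ρ` and `D (D ρ)` are epic. Hence `α` satisfies the
Eilenberg-Moore law, factors through `ρ` and yields the multiplication; the strength descends
because products preserve `ρ`. All laws are inherited from `D` by cancelling epimorphisms.

(2) ⇒ (3): a system `f` is iterated to its coiteration followed by `α`. For freeness over `Z`, a
morphism `f : Z × X ⟶ B` extends to `Z × D X` by iterating "run one step". The extension absorbs
`later` and respects Kleisli lifting by Compositionality, so it descends to `Z × Dtilde X`. To see
that the result preserves iteration, replace the outcomes of a system by a parameter: with a
parameter in `D X` the claim is Compositionality, it passes along `ρ` to parameters in `Dtilde X`,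
and the original system is recovered by taking its own solution as parameter.

Conversely, (1) gives `α` by descent of `μ ≫ ρ` along `D ρ`, (3) gives `out^♯`, and (4) gives `ρ`
followed by the multiplication. -/

theorem out_inv_now_later (X : C) : out X ≫ coprod.desc (now X) (later X) = 𝟙 (D X) := by
  have : coprod.desc (now X) (later X) = inv (out X) := by
    apply coprod.hom_ext <;> simp [now, later]
  rw [this, IsIso.hom_inv_id]

theorem delay_hom_ext {X Z : C} {m m' : D X ⟶ Z} (h₀ : now X ≫ m = now X ≫ m')
    (h₁ : later X ≫ m = later X ≫ m') : m = m' := by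
  rw [← cancel_epi (inv (out X))]
  apply coprod.hom_ext
  · simpa [now] using h₀
  · simpa [later] using h₁

theorem eq_kleisli {X Y : C} {f : X ⟶ D Y} {m : D X ⟶ D Y} (h₀ : now X ≫ m = f)
    (h₁ : later X ≫ m = m ≫ later Y) : m = kleisli f := by
  apply kleisli_unique
  apply delay_hom_ext
  · rw [reassoc_of% h₀, ← Category.assoc, now_out, coprod.inl_desc]
  · rw [reassoc_of% h₁, later_out, ← Category.assoc, later_out, coprod.inr_desc]

theorem eq_id_of_now_of_later {X : C} {m : D X ⟶ D X} (h₀ : now X ≫ m = now X)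
    (h₁ : later X ≫ m = m ≫ later X) : m = 𝟙 (D X) :=
  (eq_kleisli h₀ h₁).trans (kleisli_now X)

theorem kleisli_comp_later {X Y : C} (f : X ⟶ D Y) :
    kleisli (f ≫ later Y) = kleisli f ≫ later Y := by
  symm
  apply eq_kleisli
  · rw [← Category.assoc, now_kleisli]
  · rw [← Category.assoc, later_kleisli]

theorem coit_out_self (X : C) : coit (out X) = 𝟙 (D X) :=
  (coit_unique (by simp)).symm

theorem comp_coit {X Y Z : C} {f : Y ⟶ X ⨿ Y} {g : Z ⟶ X ⨿ Z} (h : Y ⟶ Z)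
    (w : f ≫ coprod.map (𝟙 X) h = h ≫ g) : h ≫ coit g = coit f := by
  apply coit_unique
  rw [Category.assoc, coit_out, ← reassoc_of% w, coprod.map_map, Category.id_comp]

theorem coit_mapD {X X' Y : C} (f : Y ⟶ X ⨿ Y) (h : X ⟶ X') :
    coit f ≫ mapD h = coit (f ≫ coprod.map h (𝟙 Y)) := by
  apply coit_unique
  have e : coprod.map (𝟙 X) (coit f) ≫
      coprod.desc (h ≫ coprod.inl) (kleisli (h ≫ now X') ≫ coprod.inr) =
      coprod.map h (𝟙 Y) ≫ coprod.map (𝟙 X') (coit f ≫ mapD h) := by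
    apply coprod.hom_ext <;> simp [mapD]
  rw [Category.assoc, Category.assoc, ← e, mapD, kleisli_out, reassoc_of% (coit_out f),
    Category.assoc, now_out]

end DelayBasics

/-! ### Overwriting the outcome of a computation -/

section Constant

variable {C : Type u} [Category.{v} C] [CartesianMonoidalCategory C] [FinitaryExtensive C]
  [HasDelay C]

/-- The morphism `A × D B ⟶ D A` replacing the outcome of a computation by a constant. -/
def delayConst (A B : C) : A ⊗ D B ⟶ D A := strength A B ≫ mapD (fst A B)

theorem now_delayConst (A B : C) : A ◁ now B ≫ delayConst A B = fst A B ≫ now A := by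
  rw [delayConst, ← Category.assoc, now_strength, now_mapD]

theorem later_delayConst (A B : C) :
    A ◁ later B ≫ delayConst A B = delayConst A B ≫ later A := by
  rw [delayConst, ← Category.assoc, later_strength, Category.assoc, later_mapD, Category.assoc]

theorem delayConst_naturality {A A' B B' : C} (f : A ⟶ A') (g : B ⟶ B') :
    (f ⊗ₘ mapD g) ≫ delayConst A' B' = delayConst A B ≫ mapD f := by
  rw [delayConst, ← Category.assoc, strength_naturality, delayConst, Category.assoc,
    Category.assoc, ← mapD_comp, ← mapD_comp, tensorHom_fst]

theorem lift_delayConst {A A' B B' Y : C} (f : A ⟶ A') (g : B ⟶ B') (a : Y ⟶ A) (b : Y ⟶ D B) :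
    lift (a ≫ f) (b ≫ mapD g) ≫ delayConst A' B' = lift a b ≫ delayConst A B ≫ mapD f := by
  rw [← delayConst_naturality f g, lift_map_assoc]

/-- The outcome of a computation in a search-algebra `A` is determined by its value in `A`. -/
theorem lift_delayConst_of_isSearchAlgebra {A : C} {a : D A ⟶ A} (ha : IsSearchAlgebra a) :
    lift a (𝟙 (D A)) ≫ delayConst A A = 𝟙 (D A) := by
  -- The pair `(a d, d)` is compatible with both constructors: `a` is unchanged by `later`, so the
  -- constant survives each step, and on `now x` the constant is `x` itself.
  apply eq_id_of_now_of_later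
  · have : now A ≫ lift a (𝟙 (D A)) = lift (𝟙 A) (𝟙 A) ≫ A ◁ now A := by
      ext <;> simp [ha.now]
    rw [← Category.assoc, this, Category.assoc, now_delayConst, lift_fst_assoc, Category.id_comp]
  · have : later A ≫ lift a (𝟙 (D A)) = lift a (𝟙 (D A)) ≫ A ◁ later A := by
      ext <;> simp [ha.later]
    rw [← Category.assoc, this, Category.assoc, later_delayConst, Category.assoc]

/-- The morphism `A × D (D B) ⟶ D (D A)` replacing the outcome of an iterated computation by
a constant. -/
def delayConst₂ (A B : C) : A ⊗ D (D B) ⟶ D (D A) :=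
  strength A (D B) ≫ mapD (delayConst A B)

theorem delayConst₂_naturality {A A' B B' : C} (f : A ⟶ A') (g : B ⟶ B') :
    (f ⊗ₘ mapD (mapD g)) ≫ delayConst₂ A' B' = delayConst₂ A B ≫ mapD (mapD f) := by
  rw [delayConst₂, ← Category.assoc, strength_naturality, delayConst₂, Category.assoc,
    Category.assoc, ← mapD_comp, ← mapD_comp, delayConst_naturality]

theorem lift_delayConst₂_of_isSearchAlgebra {A : C} {a : D A ⟶ A} (ha : IsSearchAlgebra a) :
    lift (mapD a ≫ a) (𝟙 (D (D A))) ≫ delayConst₂ A A = 𝟙 (D (D A)) := by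
  apply eq_id_of_now_of_later
  · have : now (D A) ≫ lift (mapD a ≫ a) (𝟙 (D (D A))) = lift a (𝟙 (D A)) ≫ A ◁ now (D A) := by
      ext
      · simp only [Category.assoc, lift_fst, whiskerLeft_fst]
        rw [reassoc_of% now_mapD, ha.now, Category.comp_id]
      · simp
    rw [← Category.assoc, this, Category.assoc, delayConst₂, reassoc_of% now_strength, now_mapD,
      ← Category.assoc, lift_delayConst_of_isSearchAlgebra ha, Category.id_comp]
  · have : later (D A) ≫ lift (mapD a ≫ a) (𝟙 (D (D A))) =
        lift (mapD a ≫ a) (𝟙 (D (D A))) ≫ A ◁ later (D A) := by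
      ext
      · simp only [Category.assoc, lift_fst, whiskerLeft_fst]
        rw [reassoc_of% later_mapD, ha.later]
      · simp
    rw [← Category.assoc, this, Category.assoc, delayConst₂, reassoc_of% later_strength,
      later_mapD]
    simp only [Category.assoc]

end Constant

/-! ### Counting and adding computation steps -/

section Counting

variable {C : Type u} [Category.{v} C] [CartesianMonoidalCategory C] [FinitaryExtensive C]
  [HasDelay C] (𝒩 : StableNNO C)

attribute [local simp] coprod.inl_desc coprod.inr_desc coprod.inl_desc_assoc coprod.inr_desc_assoc

/-- The coalgebra structure of which `countSteps` is the coiteration. -/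
def countSystem (A : C) : 𝒩.N ⊗ D A ⟶ (𝒩.N ⊗ A) ⨿ (𝒩.N ⊗ D A) :=
  𝒩.N ◁ out A ≫ dstr 𝒩.N A (D A) ≫ coprod.map (𝟙 _) (𝒩.succ ▷ D A)

/-- The morphism `N × D A ⟶ D (N × A)` adding the number of computation steps to a given number. -/
def countSteps (A : C) : 𝒩.N ⊗ D A ⟶ D (𝒩.N ⊗ A) := coit (countSystem 𝒩 A)

theorem now_countSystem (A : C) : 𝒩.N ◁ now A ≫ countSystem 𝒩 A = coprod.inl := by
  rw [countSystem, ← MonoidalCategory.whiskerLeft_comp_assoc, now_out, ← Category.assoc, inl_dstr,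
    coprod.inl_map, Category.id_comp]

theorem later_countSystem (A : C) :
    𝒩.N ◁ later A ≫ countSystem 𝒩 A = 𝒩.succ ▷ D A ≫ coprod.inr := by
  rw [countSystem, ← MonoidalCategory.whiskerLeft_comp_assoc, later_out, ← Category.assoc,
    inr_dstr, coprod.inr_map]

theorem now_countSteps (A : C) : 𝒩.N ◁ now A ≫ countSteps 𝒩 A = now (𝒩.N ⊗ A) := by
  rw [← cancel_mono (out _), Category.assoc, countSteps, coit_out, ← Category.assoc,
    now_countSystem, now_out, coprod.inl_map, Category.id_comp]

theorem later_countSteps (A : C) :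
    𝒩.N ◁ later A ≫ countSteps 𝒩 A = 𝒩.succ ▷ D A ≫ countSteps 𝒩 A ≫ later (𝒩.N ⊗ A) := by
  rw [← cancel_mono (out _), Category.assoc, countSteps, coit_out, ← Category.assoc,
    later_countSystem, Category.assoc, coprod.inr_map, Category.assoc, Category.assoc, later_out]

/-- Both morphisms solve the same guarded corecursive system, in which the counter grows at each
step; such a solution is unique. -/
theorem counting_ext {A B : C} {m m' : 𝒩.N ⊗ D A ⟶ D B}
    (h₀ : 𝒩.N ◁ now A ≫ m = 𝒩.N ◁ now A ≫ m')
    (h₁ : 𝒩.N ◁ later A ≫ m = 𝒩.succ ▷ D A ≫ m ≫ later B)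
    (h₁' : 𝒩.N ◁ later A ≫ m' = 𝒩.succ ▷ D A ≫ m' ≫ later B) : m = m' := by
  have key : ∀ k : 𝒩.N ⊗ D A ⟶ D B, 𝒩.N ◁ now A ≫ k = 𝒩.N ◁ now A ≫ m →
      𝒩.N ◁ later A ≫ k = 𝒩.succ ▷ D A ≫ k ≫ later B →
      k ≫ out B = countSystem 𝒩 A ≫ coprod.desc ((𝒩.N ◁ now A ≫ m) ≫ out B) (k ≫ coprod.inr) := by
    intro k hk₀ hk₁
    apply prod_delay_hom_ext
    · rw [← Category.assoc, hk₀, reassoc_of% now_countSystem, coprod.inl_desc]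
    · rw [← Category.assoc, hk₁, reassoc_of% later_countSystem, coprod.inr_desc]
      simp only [Category.assoc, later_out]
  exact solution_unique (key m rfl h₁) (key m' h₀.symm h₁')

/-- The morphism `N × D X ⟶ D X` adding a given number of computation steps. -/
def addSteps (X : C) : 𝒩.N ⊗ D X ⟶ D X :=
  strength 𝒩.N X ≫ mapD (lift (snd _ _) (fst _ _)) ≫ iotaStar 𝒩 X

theorem addSteps_eq (X : C) :
    addSteps 𝒩 X = strength 𝒩.N X ≫ kleisli (lift (snd _ _) (fst _ _) ≫ iota 𝒩 X) := by
  rw [addSteps, iotaStar, mapD_kleisli]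

theorem later_addSteps (X : C) : 𝒩.N ◁ later X ≫ addSteps 𝒩 X = addSteps 𝒩 X ≫ later X := by
  rw [addSteps_eq, reassoc_of% later_strength, later_kleisli, Category.assoc]

/-- The delay is inserted at the end of the computation, but `later` commutes with Kleisli lifting,
so one more step at the end equals one more at the beginning. -/
theorem succ_addSteps (X : C) : 𝒩.succ ▷ D X ≫ addSteps 𝒩 X = addSteps 𝒩 X ≫ later X := by
  have h : 𝒩.succ ▷ D X = (𝒩.succ ⊗ₘ mapD (𝟙 X)) := by
    rw [mapD_id, tensorHom_id]
  have h' : (𝒩.succ ⊗ₘ 𝟙 X) ≫ lift (snd _ _) (fst _ _) =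
      lift (snd 𝒩.N X) (fst 𝒩.N X) ≫ X ◁ 𝒩.succ := by
    ext <;> simp
  rw [addSteps_eq, h, ← Category.assoc, strength_naturality, Category.assoc, mapD_kleisli,
    reassoc_of% h', iota, 𝒩.succ_init, Category.assoc, ← kleisli_comp_later, Category.assoc]

theorem zero_addSteps (X : C) :
    lift (toUnit (D X) ≫ 𝒩.zero) (𝟙 (D X)) ≫ addSteps 𝒩 X = 𝟙 (D X) := by
  apply eq_id_of_now_of_later
  · have h : now X ≫ lift (toUnit (D X) ≫ 𝒩.zero) (𝟙 (D X)) =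
        lift (toUnit X ≫ 𝒩.zero) (𝟙 X) ≫ 𝒩.N ◁ now X := by
      ext <;> simp
    have h' : lift (toUnit X ≫ 𝒩.zero) (𝟙 X) ≫ lift (snd 𝒩.N X) (fst 𝒩.N X) =
        lift (𝟙 X) (toUnit X ≫ 𝒩.zero) := by
      ext <;> simp
    rw [reassoc_of% h, addSteps_eq, reassoc_of% now_strength, now_kleisli, reassoc_of% h', iota,
      𝒩.zero_init]
  · have h : later X ≫ lift (toUnit (D X) ≫ 𝒩.zero) (𝟙 (D X)) =
        lift (toUnit (D X) ≫ 𝒩.zero) (𝟙 (D X)) ≫ 𝒩.N ◁ later X := by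
      ext <;> simp
    rw [reassoc_of% h, later_addSteps, Category.assoc]

/-- Annotation of an iterated computation by the number of steps of the outer computation. -/
def annotate (X : C) : D (D X) ⟶ D (D (X ⊗ 𝒩.N)) :=
  lift (toUnit _ ≫ 𝒩.zero) (𝟙 _) ≫ countSteps 𝒩 (D X) ≫
    mapD (strength 𝒩.N X ≫ mapD (lift (snd _ _) (fst _ _)))

/-- The tag is only data: counting does not change the timing, so erasing it recovers the
computation. -/
theorem annotate_mapFst (X : C) : annotate 𝒩 X ≫ mapD (mapFst 𝒩 X) = 𝟙 (D (D X)) := by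
  have h : countSteps 𝒩 (D X) ≫ mapD (snd 𝒩.N (D X)) = snd 𝒩.N (D (D X)) := by
    apply counting_ext
    · rw [reassoc_of% now_countSteps, now_mapD, whiskerLeft_snd]
    · rw [reassoc_of% later_countSteps, later_mapD, Category.assoc]
    · rw [whiskerLeft_snd, whiskerRight_snd_assoc]
  have h' : strength 𝒩.N X ≫ mapD (lift (snd _ _) (fst _ _)) ≫ mapFst 𝒩 X = snd 𝒩.N (D X) := by
    change _ ≫ _ ≫ mapD _ = _
    rw [← mapD_comp, lift_fst, strength_snd]
  rw [annotate, Category.assoc, Category.assoc, ← mapD_comp, Category.assoc, h', h, lift_snd]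

/-- If the outer computation takes `n` steps to reach `e`, the tag causes `n` steps to be added to
`e`, which is the flattening of the whole. With the previous lemma this exhibits "overwrite by `μ`"
and the identity as composites of `annotate` with the two arrows coequalized by `D ρ`. -/
theorem annotate_iotaStar (X : C) :
    annotate 𝒩 X ≫ mapD (iotaStar 𝒩 X) = lift (mult X) (𝟙 _) ≫ delayConst (D X) (D X) := by
  -- For the corecursion the counter must start at an arbitrary `n`, whose steps are then also added
  -- on the right. The invariant is that a step may be moved from the computation to the counter.
  have h : countSteps 𝒩 (D X) ≫ mapD (addSteps 𝒩 X) =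
      lift (𝒩.N ◁ mult X ≫ addSteps 𝒩 X) (snd _ _) ≫ delayConst (D X) (D X) := by
    apply counting_ext
    · have e : 𝒩.N ◁ now (D X) ≫ lift (𝒩.N ◁ mult X ≫ addSteps 𝒩 X) (snd _ _) =
          lift (addSteps 𝒩 X) (snd _ _) ≫ D X ◁ now (D X) := by
        ext
        · simp only [Category.assoc, lift_fst, whiskerLeft_fst]
          rw [← MonoidalCategory.whiskerLeft_comp_assoc, now_mult, MonoidalCategory.whiskerLeft_id,
            Category.id_comp]
        · simp
      rw [reassoc_of% now_countSteps, now_mapD, reassoc_of% e, now_delayConst, lift_fst_assoc]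
    · rw [reassoc_of% later_countSteps, later_mapD, Category.assoc]
    · have e : 𝒩.N ◁ later (D X) ≫ lift (𝒩.N ◁ mult X ≫ addSteps 𝒩 X) (snd _ _) =
          𝒩.succ ▷ _ ≫ lift (𝒩.N ◁ mult X ≫ addSteps 𝒩 X) (snd _ _) ≫ D X ◁ later (D X) := by
        ext
        · simp only [Category.assoc, lift_fst, whiskerLeft_fst]
          rw [← MonoidalCategory.whiskerLeft_comp_assoc, later_mult,
            MonoidalCategory.whiskerLeft_comp_assoc, later_addSteps, ← succ_addSteps,
            whisker_exchange_assoc]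
        · simp
      rw [reassoc_of% e, later_delayConst, Category.assoc]
  rw [annotate, Category.assoc, Category.assoc, ← mapD_comp, Category.assoc]
  rw [← addSteps, h, ← Category.assoc]
  congr 1
  ext
  · have e : lift (toUnit _ ≫ 𝒩.zero) (𝟙 (D (D X))) ≫ 𝒩.N ◁ mult X =
        mult X ≫ lift (toUnit _ ≫ 𝒩.zero) (𝟙 _) := by
      ext <;> simp
    simp only [Category.assoc, lift_fst]
    rw [reassoc_of% e, zero_addSteps, Category.comp_id]
  · simp

end Counting

/-! ### From preservation by `D` to a search-algebra -/

section QuotientBasics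

variable {C : Type u} [Category.{v} C] [CartesianMonoidalCategory C] [HasBinaryCoproducts C]
  [HasDelay C] (𝒩 : StableNNO C) [HasDelayQuotient 𝒩]

/-- Along `x ↦ (x, 1)`, the two coequalized arrows restrict to `later` and the identity. -/
theorem later_rho (X : C) : later X ≫ rho 𝒩 X = rho 𝒩 X := by
  have h : mapD (lift (𝟙 X) (toUnit X ≫ 𝒩.zero) ≫ X ◁ 𝒩.succ) ≫ iotaStar 𝒩 X = later X := by
    rw [iotaStar, mapD_kleisli, iota, Category.assoc, 𝒩.succ_init, reassoc_of% 𝒩.zero_init,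
      kleisli_comp_later, kleisli_now, Category.id_comp]
  have h' : mapD (lift (𝟙 X) (toUnit X ≫ 𝒩.zero) ≫ X ◁ 𝒩.succ) ≫ mapFst 𝒩 X = 𝟙 (D X) := by
    change mapD _ ≫ mapD _ = _
    rw [← mapD_comp, Category.assoc, whiskerLeft_fst, lift_fst, mapD_id]
  rw [← h, Category.assoc, rho_condition, reassoc_of% h']

theorem exists_mapD_rho_comp_eq_of_preserves {X B : C}
    [PreservesColimit (parallelPair (iotaStar 𝒩 X) (mapFst 𝒩 X)) (delayFunctor C)]
    (u : D (D X) ⟶ B) (hu : mapD (iotaStar 𝒩 X) ≫ u = mapD (mapFst 𝒩 X) ≫ u) :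
    ∃ k : D (Dtilde 𝒩 X) ⟶ B, mapD (rho 𝒩 X) ≫ k = u := by
  obtain ⟨k, hk⟩ := Cofork.IsColimit.desc' (isColimitOfHasCoequalizerOfPreservesColimit
    (delayFunctor C) (iotaStar 𝒩 X) (mapFst 𝒩 X)) u hu
  exact ⟨k, hk⟩

theorem mapD_rho_hom_ext_of_preserves {X B : C}
    [PreservesColimit (parallelPair (iotaStar 𝒩 X) (mapFst 𝒩 X)) (delayFunctor C)]
    {f g : D (Dtilde 𝒩 X) ⟶ B} (h : mapD (rho 𝒩 X) ≫ f = mapD (rho 𝒩 X) ≫ g) : f = g :=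
  Cofork.IsColimit.hom_ext (isColimitOfHasCoequalizerOfPreservesColimit
    (delayFunctor C) (iotaStar 𝒩 X) (mapFst 𝒩 X)) h

theorem exists_searchAlgebra_of_preserves (X : C)
    [PreservesColimit (parallelPair (iotaStar 𝒩 X) (mapFst 𝒩 X)) (delayFunctor C)] :
    ∃ α : D (Dtilde 𝒩 X) ⟶ Dtilde 𝒩 X,
      IsSearchAlgebra α ∧ IsDAlgebraMorphism (mult X) α (rho 𝒩 X) := by
  have w : mapD (iotaStar 𝒩 X) ≫ mult X ≫ rho 𝒩 X = mapD (mapFst 𝒩 X) ≫ mult X ≫ rho 𝒩 X := by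
    have h₁ : mapD (iotaStar 𝒩 X) ≫ mult X = mult _ ≫ iotaStar 𝒩 X := by
      rw [mapD_mult, iotaStar, mult, kleisli_kleisli, Category.id_comp]
    have h₂ : mapD (mapFst 𝒩 X) ≫ mult X = mult _ ≫ mapFst 𝒩 X := by
      rw [mapD_mult, mult, mapFst]
      change _ = _ ≫ mapD _
      rw [kleisli_mapD, Category.id_comp]
    rw [reassoc_of% h₁, reassoc_of% h₂, rho_condition]
  obtain ⟨α, hα⟩ := exists_mapD_rho_comp_eq_of_preserves 𝒩 _ w
  refine ⟨α, ⟨?_, ?_⟩, hα.symm⟩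
  · apply dtilde_hom_ext
    rw [← reassoc_of% now_mapD, hα, reassoc_of% now_mult, Category.comp_id]
  · apply mapD_rho_hom_ext_of_preserves
    rw [← reassoc_of% later_mapD, hα, reassoc_of% later_mult, later_rho]

end QuotientBasics

/-! ### Transfer of the coequalizer property from `ρ × id` to `D ρ` -/

section QuotientProducts

variable {C : Type u} [Category.{v} C] [CartesianMonoidalCategory C] [FinitaryExtensive C]
  [HasDelay C] {𝒩 : StableNNO C} [HasDelayQuotient 𝒩]

theorem exists_searchAlgebra_of_strongMonad {M : StrongMonadStr (dtildeFunctor 𝒩)}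
    (hM : IsStrongMonadMorphism (delayStrongMonad C) M (rhoNat 𝒩)) (X : C) :
    ∃ α : D (Dtilde 𝒩 X) ⟶ Dtilde 𝒩 X,
      IsSearchAlgebra α ∧ IsDAlgebraMorphism (mult X) α (rho 𝒩 X) := by
  -- A `Dtilde`-algebra restricts along `ρ` to a `D`-algebra; it absorbs `later` because `ρ` does.
  refine ⟨rho 𝒩 (Dtilde 𝒩 X) ≫ M.μ X, ⟨?_, ?_⟩, hM.mult X⟩
  · have h : now (Dtilde 𝒩 X) ≫ rho 𝒩 (Dtilde 𝒩 X) = M.η (Dtilde 𝒩 X) := hM.unit _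
    rw [reassoc_of% h]
    exact M.left_unit X
  · rw [← Category.assoc, later_rho]

variable (hp : ∀ X Y : C,
  PreservesColimit (parallelPair (iotaStar 𝒩 Y) (mapFst 𝒩 Y)) (tensorLeft X))

include hp

theorem exists_whiskerLeft_rho_comp_eq {Z X B : C} (u : Z ⊗ D X ⟶ B)
    (hu : Z ◁ iotaStar 𝒩 X ≫ u = Z ◁ mapFst 𝒩 X ≫ u) :
    ∃ k : Z ⊗ Dtilde 𝒩 X ⟶ B, Z ◁ rho 𝒩 X ≫ k = u := by
  have := hp Z X
  obtain ⟨k, hk⟩ := Cofork.IsColimit.desc' (isColimitOfHasCoequalizerOfPreservesColimit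
    (tensorLeft Z) (iotaStar 𝒩 X) (mapFst 𝒩 X)) u hu
  exact ⟨k, hk⟩

theorem whiskerLeft_rho_hom_ext {Z X B : C} {f g : Z ⊗ Dtilde 𝒩 X ⟶ B}
    (h : Z ◁ rho 𝒩 X ≫ f = Z ◁ rho 𝒩 X ≫ g) : f = g := by
  have := hp Z X
  exact Cofork.IsColimit.hom_ext (isColimitOfHasCoequalizerOfPreservesColimit
    (tensorLeft Z) (iotaStar 𝒩 X) (mapFst 𝒩 X)) h

theorem exists_whiskerRight_rho_comp_eq {Z X B : C} (u : D X ⊗ Z ⟶ B)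
    (hu : iotaStar 𝒩 X ▷ Z ≫ u = mapFst 𝒩 X ▷ Z ≫ u) :
    ∃ k : Dtilde 𝒩 X ⊗ Z ⟶ B, rho 𝒩 X ▷ Z ≫ k = u := by
  have e : ∀ {A A' : C} (k : A ⟶ A'), Z ◁ k ≫ lift (snd Z A') (fst Z A') =
      lift (snd Z A) (fst Z A) ≫ k ▷ Z := by
    intros
    ext <;> simp
  obtain ⟨k, hk⟩ := exists_whiskerLeft_rho_comp_eq hp (lift (snd Z (D X)) (fst Z (D X)) ≫ u)
    (by rw [reassoc_of% e, hu, reassoc_of% e])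
  refine ⟨lift (snd _ _) (fst _ _) ≫ k, ?_⟩
  have e' : rho 𝒩 X ▷ Z ≫ lift (snd _ _) (fst _ _) = lift (snd _ _) (fst _ _) ≫ Z ◁ rho 𝒩 X := by
    ext <;> simp
  rw [reassoc_of% e', hk, ← Category.assoc]
  convert Category.id_comp u
  ext <;> simp

theorem whiskerRight_rho_hom_ext {Z X B : C} {f g : Dtilde 𝒩 X ⊗ Z ⟶ B}
    (h : rho 𝒩 X ▷ Z ≫ f = rho 𝒩 X ▷ Z ≫ g) : f = g := by
  have e : Z ◁ rho 𝒩 X ≫ lift (snd _ _) (fst _ _) = lift (snd _ _) (fst _ _) ≫ rho 𝒩 X ▷ Z := by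
    ext <;> simp
  have h' : lift (snd Z (Dtilde 𝒩 X)) (fst Z (Dtilde 𝒩 X)) ≫ f = lift (snd _ _) (fst _ _) ≫ g := by
    apply whiskerLeft_rho_hom_ext hp
    rw [reassoc_of% e, h, reassoc_of% e]
  have e' : lift (snd (Dtilde 𝒩 X) Z) (fst (Dtilde 𝒩 X) Z) ≫ lift (snd _ _) (fst _ _) =
      𝟙 (Dtilde 𝒩 X ⊗ Z) := by
    ext <;> simp
  rw [← Category.id_comp f, ← Category.id_comp g, ← e', Category.assoc, Category.assoc, h']

variable {X : C} {α : D (Dtilde 𝒩 X) ⟶ Dtilde 𝒩 X}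

/-- Overwriting turns an element of `D X`, given up to `ρ`, and a timing into an element of `D (D
X)` on which `u` is well defined. The factorization feeds it the value and the timing of the same
computation. -/
theorem exists_mapD_rho_comp_eq (hρ : IsDAlgebraMorphism (mult X) α (rho 𝒩 X)) {B : C}
    (u : D (D X) ⟶ B)
    (hu : mapD (iotaStar 𝒩 X) ≫ u = mapD (mapFst 𝒩 X) ≫ u) :
    ∃ k : D (Dtilde 𝒩 X) ⟶ B, mapD (rho 𝒩 X) ≫ k = u := by
  have hρ' : mult X ≫ rho 𝒩 X = mapD (rho 𝒩 X) ≫ α := hρ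
  have hd : ∀ {A : C} (k : A ⟶ D X), k ▷ D (Dtilde 𝒩 X) ≫ delayConst _ _ =
      delayConst _ _ ≫ mapD k := by
    intro A k
    rw [← delayConst_naturality k (𝟙 (Dtilde 𝒩 X)), mapD_id, tensorHom_id]
  obtain ⟨k, hk⟩ := exists_whiskerRight_rho_comp_eq hp (delayConst (D X) (Dtilde 𝒩 X) ≫ u)
    (by rw [reassoc_of% hd, hu, reassoc_of% hd])
  refine ⟨lift α (𝟙 _) ≫ k, ?_⟩
  have e : mapD (rho 𝒩 X) ≫ lift α (𝟙 _) =
      lift (mult X) (mapD (rho 𝒩 X)) ≫ rho 𝒩 X ▷ _ := by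
    ext <;> simp [hρ']
  have e' := lift_delayConst (𝟙 (D X)) (rho 𝒩 X) (mult X) (𝟙 _)
  rw [mapD_id, Category.comp_id, Category.comp_id, Category.id_comp] at e'
  -- What remains is `u` after overwriting by `μ`, and `u` identifies this with the identity through
  -- `annotate`.
  rw [reassoc_of% e, hk, reassoc_of% e', ← reassoc_of% annotate_iotaStar 𝒩, hu,
    reassoc_of% annotate_mapFst]

variable (hα : IsSearchAlgebra α)

include hα

theorem whiskerLeft_mapD_rho_hom_ext {Z B : C} {f g : Z ⊗ D (Dtilde 𝒩 X) ⟶ B}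
    (h : Z ◁ mapD (rho 𝒩 X) ≫ f = Z ◁ mapD (rho 𝒩 X) ≫ g) : f = g := by
  -- `s` overwrites the outcome in the last component. It is split by the section `(z, d) ↦ (α d, z,
  -- d)`, and on parameters of the form `ρ x` it factors through `Z × D ρ`.
  let s : Dtilde 𝒩 X ⊗ (Z ⊗ D (Dtilde 𝒩 X)) ⟶ Z ⊗ D (Dtilde 𝒩 X) :=
    lift (snd _ _ ≫ fst _ _) (lift (fst _ _) (snd _ _ ≫ snd _ _) ≫ delayConst _ _)
  have key : s ≫ f = s ≫ g := by
    apply whiskerRight_rho_hom_ext hp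
    have e : rho 𝒩 X ▷ (Z ⊗ D (Dtilde 𝒩 X)) ≫ s =
        lift (snd _ _ ≫ fst _ _) (lift (fst _ _) (snd _ _ ≫ snd _ _) ≫ delayConst _ _) ≫
          Z ◁ mapD (rho 𝒩 X) := by
      ext
      · simp [s]
      · have := lift_delayConst (rho 𝒩 X) (𝟙 (Dtilde 𝒩 X)) (fst (D X) (Z ⊗ D (Dtilde 𝒩 X)))
          (snd _ _ ≫ snd _ _)
        rw [mapD_id, Category.comp_id] at this
        simp only [s, comp_lift, Category.assoc, lift_snd, whiskerLeft_snd, lift_snd_assoc,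
          ← this]
        rw [comp_lift_assoc]
        simp
    rw [reassoc_of% e, h, reassoc_of% e]
  have e : lift (snd _ _ ≫ α) (𝟙 _) ≫ s = 𝟙 (Z ⊗ D (Dtilde 𝒩 X)) := by
    ext
    · simp [s]
    · simp only [s, comp_lift, lift_snd, Category.id_comp, lift_fst, comp_lift_assoc,
        lift_snd_assoc]
      have : lift (snd Z (D (Dtilde 𝒩 X)) ≫ α) (snd Z (D (Dtilde 𝒩 X))) =
          snd _ _ ≫ lift α (𝟙 _) := by
        ext <;> simp
      rw [this, Category.assoc, lift_delayConst_of_isSearchAlgebra hα, Category.comp_id]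
  rw [← Category.id_comp f, ← Category.id_comp g, ← e, Category.assoc, Category.assoc, key]

theorem mapD_rho_hom_ext {B : C} {f g : D (Dtilde 𝒩 X) ⟶ B}
    (h : mapD (rho 𝒩 X) ≫ f = mapD (rho 𝒩 X) ≫ g) : f = g := by
  have key : snd (𝟙_ C) _ ≫ f = snd (𝟙_ C) _ ≫ g := by
    apply whiskerLeft_mapD_rho_hom_ext hp hα
    rw [whiskerLeft_snd_assoc, whiskerLeft_snd_assoc, h]
  simpa using congrArg (fun k => lift (toUnit _) (𝟙 _) ≫ k) key

theorem mapD_mapD_rho_hom_ext {B : C} {f g : D (D (Dtilde 𝒩 X)) ⟶ B}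
    (h : mapD (mapD (rho 𝒩 X)) ≫ f = mapD (mapD (rho 𝒩 X)) ≫ g) : f = g := by
  have key : delayConst₂ (Dtilde 𝒩 X) (Dtilde 𝒩 X) ≫ f = delayConst₂ _ _ ≫ g := by
    apply whiskerRight_rho_hom_ext hp
    have e := delayConst₂_naturality (rho 𝒩 X) (𝟙 (Dtilde 𝒩 X))
    rw [mapD_id, mapD_id, tensorHom_id] at e
    rw [reassoc_of% e, h, reassoc_of% e]
  rw [← Category.id_comp f, ← Category.id_comp g, ← lift_delayConst₂_of_isSearchAlgebra hα,
    Category.assoc, Category.assoc, key]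

variable (hρ : IsDAlgebraMorphism (mult X) α (rho 𝒩 X))

include hρ

theorem preservesColimit_delayFunctor :
    PreservesColimit (parallelPair (iotaStar 𝒩 X) (mapFst 𝒩 X)) (delayFunctor C) := by
  refine preservesColimit_of_preserves_colimit_cocone
    (coequalizerIsCoequalizer (iotaStar 𝒩 X) (mapFst 𝒩 X)) ?_
  refine (isColimitMapCoconeCoforkEquiv (delayFunctor C) _).symm ?_
  refine Cofork.IsColimit.mk' _ fun s => ?_
  have hs := exists_mapD_rho_comp_eq hp hρ s.π s.condition
  exact ⟨hs.choose, hs.choose_spec, fun {m} hm =>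
    mapD_rho_hom_ext hp hα (hm.trans hs.choose_spec.symm)⟩

/-- Precomposed with the epimorphism `D (D ρ)`, both sides become associativity of `μ` on `D X`. -/
theorem mult_comp_eq_mapD_comp : mult (Dtilde 𝒩 X) ≫ α = mapD α ≫ α := by
  have hρ' : mult X ≫ rho 𝒩 X = mapD (rho 𝒩 X) ≫ α := hρ
  apply mapD_mapD_rho_hom_ext hp hα
  have e : mapD (mapD (rho 𝒩 X)) ≫ mult _ = mult _ ≫ mapD (rho 𝒩 X) :=
    (delayStrongMonad C).μ_naturality (rho 𝒩 X)
  have e' : mapD (mult X) ≫ mult X = mult _ ≫ mult X := (delayStrongMonad C).assoc X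
  rw [reassoc_of% e, ← hρ', ← Category.assoc (mapD _) (mapD _), ← mapD_comp, ← hρ', mapD_comp,
    Category.assoc, ← hρ', reassoc_of% e']

end QuotientProducts

/-! ### Eilenberg-Moore search-algebras coequalize `ι^⋆` and `D fst` -/

section SearchEM

variable {C : Type u} [Category.{v} C] [CartesianMonoidalCategory C] [HasBinaryCoproducts C]
  [HasDelay C] (𝒩 : StableNNO C)

theorem iota_comp_of_isSearchAlgebra {A : C} {a : D A ⟶ A} (ha : IsSearchAlgebra a) :
    iota 𝒩 A ≫ a = fst A 𝒩.N := by
  trans 𝒩.init (𝟙 A) (𝟙 A)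
  · apply 𝒩.init_unique
    · rw [iota, reassoc_of% 𝒩.zero_init, ha.now]
    · rw [iota, reassoc_of% 𝒩.succ_init, ha.later, Category.comp_id]
  · symm
    apply 𝒩.init_unique <;> simp

theorem iotaStar_comp_of_isSearchAlgebra {A : C} {a : D A ⟶ A} (ha : IsSearchAlgebra a)
    (hm : mult A ≫ a = mapD a ≫ a) : iotaStar 𝒩 A ≫ a = mapFst 𝒩 A ≫ a := by
  rw [iotaStar, ← mapD_mult, Category.assoc, hm, ← Category.assoc, ← mapD_comp,
    iota_comp_of_isSearchAlgebra 𝒩 ha]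
  rfl

end SearchEM

/-! ### The strong monad structure on the quotient -/

section StrengthKleisli

variable {C : Type u} [Category.{v} C] [CartesianMonoidalCategory C] [FinitaryExtensive C]
  [HasDelay C] (𝒩 : StableNNO C)

theorem whiskerLeft_mapD_strength (X : C) {Y Z : C} (k : Y ⟶ Z) :
    X ◁ mapD k ≫ strength X Z = strength X Y ≫ mapD (X ◁ k) := by
  rw [← id_tensorHom, strength_naturality, id_tensorHom]

theorem whiskerLeft_kleisli_strength (X : C) {Y Z : C} (k : Y ⟶ D Z) :
    X ◁ kleisli k ≫ strength X Z = strength X Y ≫ kleisli (X ◁ k ≫ strength X Z) := by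
  rw [← mapD_mult, MonoidalCategory.whiskerLeft_comp_assoc, strength_mult,
    reassoc_of% whiskerLeft_mapD_strength, ← mapD_mult, mapD_comp, Category.assoc]

theorem whiskerLeft_iota_strength (X Y : C) :
    X ◁ iota 𝒩 Y ≫ strength X Y = (α_ X Y 𝒩.N).inv ≫ iota 𝒩 (X ⊗ Y) := by
  rw [Iso.eq_inv_comp]
  apply 𝒩.init_unique
  · have e : lift (𝟙 (X ⊗ Y)) (toUnit (X ⊗ Y) ≫ 𝒩.zero) ≫ (α_ X Y 𝒩.N).hom =
        X ◁ lift (𝟙 Y) (toUnit Y ≫ 𝒩.zero) := by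
      ext <;> simp
    rw [reassoc_of% e, ← MonoidalCategory.whiskerLeft_comp_assoc, iota, 𝒩.zero_init, now_strength]
  · rw [associator_naturality_right_assoc, ← MonoidalCategory.whiskerLeft_comp_assoc, iota,
      𝒩.succ_init, MonoidalCategory.whiskerLeft_comp_assoc, later_strength]
    simp only [Category.assoc]

/-- The strength carries the parallel pair at `Y` to the one at `X × Y`, up to reassociating the
counter, so it descends to the quotient. -/
theorem strength_rho_condition [HasDelayQuotient 𝒩] (X Y : C) :
    X ◁ iotaStar 𝒩 Y ≫ strength X Y ≫ rho 𝒩 (X ⊗ Y) =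
      X ◁ mapFst 𝒩 Y ≫ strength X Y ≫ rho 𝒩 (X ⊗ Y) := by
  have h₁ : X ◁ iotaStar 𝒩 Y ≫ strength X Y =
      strength X (Y ⊗ 𝒩.N) ≫ mapD (α_ X Y 𝒩.N).inv ≫ iotaStar 𝒩 (X ⊗ Y) := by
    rw [iotaStar, whiskerLeft_kleisli_strength, whiskerLeft_iota_strength, iotaStar, mapD_kleisli]
  have h₂ : X ◁ mapFst 𝒩 Y ≫ strength X Y =
      strength X (Y ⊗ 𝒩.N) ≫ mapD (α_ X Y 𝒩.N).inv ≫ mapFst 𝒩 (X ⊗ Y) := by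
    change X ◁ mapD _ ≫ _ = _ ≫ _ ≫ mapD _
    rw [whiskerLeft_mapD_strength, ← mapD_comp]
    congr 2
    ext <;> simp
  rw [reassoc_of% h₁, reassoc_of% h₂, rho_condition]

variable {𝒩} [HasDelayQuotient 𝒩]
  (hp : ∀ X Y : C, PreservesColimit (parallelPair (iotaStar 𝒩 Y) (mapFst 𝒩 Y)) (tensorLeft X))
  {α : ∀ X : C, D (Dtilde 𝒩 X) ⟶ Dtilde 𝒩 X} (hα : ∀ X, IsSearchAlgebra (α X))
  (hρ : ∀ X, IsDAlgebraMorphism (mult X) (α X) (rho 𝒩 X))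

include hp hα hρ

theorem mapD_dtildeMap_searchAlgebra {X Y : C} (f : X ⟶ Y) :
    mapD (dtildeMap 𝒩 f) ≫ α Y = α X ≫ dtildeMap 𝒩 f := by
  have hρ' : ∀ X, mult X ≫ rho 𝒩 X = mapD (rho 𝒩 X) ≫ α X := hρ
  have e : mapD (mapD f) ≫ mult _ = mult _ ≫ mapD f :=
    (delayStrongMonad C).μ_naturality f
  apply mapD_rho_hom_ext hp (hα X)
  rw [← Category.assoc, ← mapD_comp, rho_dtildeMap, mapD_comp, Category.assoc, ← hρ',
    reassoc_of% e, ← reassoc_of% hρ', rho_dtildeMap]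

theorem exists_strongMonad_of_searchAlgebra :
    ∃ M : StrongMonadStr (dtildeFunctor 𝒩),
      IsStrongMonadMorphism (delayStrongMonad C) M (rhoNat 𝒩) := by
  have hρ' : ∀ X, mult X ≫ rho 𝒩 X = mapD (rho 𝒩 X) ≫ α X := hρ
  have hμ : ∀ X, ∃ k : Dtilde 𝒩 (Dtilde 𝒩 X) ⟶ Dtilde 𝒩 X, rho 𝒩 _ ≫ k = α X := fun X =>
    ⟨coequalizer.desc (α X) (iotaStar_comp_of_isSearchAlgebra 𝒩 (hα X)
      (mult_comp_eq_mapD_comp hp (hα X) (hρ X))), coequalizer.π_desc _ _⟩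
  choose μ hμ using hμ
  have hτ : ∀ X Y, ∃ k : X ⊗ Dtilde 𝒩 Y ⟶ Dtilde 𝒩 (X ⊗ Y),
      X ◁ rho 𝒩 Y ≫ k = strength X Y ≫ rho 𝒩 (X ⊗ Y) := fun X Y =>
    exists_whiskerLeft_rho_comp_eq hp _ (strength_rho_condition 𝒩 X Y)
  choose τ hτ using hτ
  refine ⟨⟨fun X => now X ≫ rho 𝒩 X, μ, τ, ?_, ?_, ?_, ?_, ?_, ?_, ?_, ?_, ?_, ?_⟩, ?_⟩
  · intro X Y f
    rw [← reassoc_of% now_mapD, Category.assoc, rho_dtildeMap]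
  · intro X Y f
    apply dtilde_hom_ext
    rw [reassoc_of% rho_dtildeMap, hμ, reassoc_of% hμ, mapD_dtildeMap_searchAlgebra hp hα hρ]
  · intro X X' Y Y' f g
    apply whiskerLeft_rho_hom_ext hp
    have e : X ◁ rho 𝒩 Y ≫ (f ⊗ₘ dtildeMap 𝒩 g) = (f ⊗ₘ mapD g) ≫ X' ◁ rho 𝒩 Y' := by
      ext <;> simp [rho_dtildeMap]
    rw [reassoc_of% e, hτ, reassoc_of% strength_naturality, reassoc_of% hτ, rho_dtildeMap]
  · intro X
    apply dtilde_hom_ext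
    rw [reassoc_of% rho_dtildeMap, hμ, reassoc_of% hμ]
    apply mapD_rho_hom_ext hp (hα _)
    rw [← Category.assoc, ← mapD_comp, hμ, ← reassoc_of% hρ', hμ,
      mult_comp_eq_mapD_comp hp (hα X) (hρ X)]
  · intro X
    rw [Category.assoc, hμ, (hα X).now]
  · intro X
    apply dtilde_hom_ext
    have e : mapD (now X) ≫ mult X = 𝟙 _ := (delayStrongMonad C).right_unit X
    rw [reassoc_of% rho_dtildeMap, hμ, mapD_comp, Category.assoc, ← hρ', reassoc_of% e,
      Category.comp_id]
  · intro X Y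
    apply whiskerLeft_rho_hom_ext hp
    rw [reassoc_of% hτ, rho_dtildeMap, reassoc_of% strength_snd, whiskerLeft_snd]
  · intro X Y Z
    apply whiskerLeft_rho_hom_ext hp
    rw [reassoc_of% hτ, rho_dtildeMap, reassoc_of% strength_assoc,
      associator_naturality_right_assoc, ← MonoidalCategory.whiskerLeft_comp_assoc, hτ,
      MonoidalCategory.whiskerLeft_comp_assoc, hτ]
  · intro X Y
    rw [MonoidalCategory.whiskerLeft_comp_assoc, hτ, reassoc_of% now_strength]
  · intro X Y
    apply whiskerLeft_rho_hom_ext hp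
    rw [reassoc_of% hτ, reassoc_of% rho_dtildeMap, hμ, ← MonoidalCategory.whiskerLeft_comp_assoc,
      hμ]
    -- The law involves two layers of `Dtilde`; the outer one is already lifted along `ρ`, and the
    -- inner one is lifted by cancelling `X × D ρ`.
    apply whiskerLeft_mapD_rho_hom_ext hp (hα _)
    rw [← MonoidalCategory.whiskerLeft_comp_assoc, ← hρ', MonoidalCategory.whiskerLeft_comp_assoc,
      hτ, reassoc_of% strength_mult, reassoc_of% whiskerLeft_mapD_strength,
      ← Category.assoc (mapD _) (mapD _), ← mapD_comp, hτ, mapD_comp, Category.assoc, ← hρ']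
  · exact ⟨fun X => rfl, fun X => by
      change mult X ≫ rho 𝒩 X = mapD (rho 𝒩 X) ≫ rho 𝒩 _ ≫ μ X
      rw [hμ, hρ'], fun X Y => (hτ X Y).symm⟩

end StrengthKleisli

/-! ### Elgot algebras over a base, in terms of coproducts of `C` -/

section Relative

variable {C : Type u} [Category.{v} C] [HasBinaryCoproducts C]

/-- An Elgot algebra in the slice category over `Z` on `p : B ⟶ Z`, expressed by means of the
coproducts of the ambient category. -/
structure RelElgotAlgebra {Z B : C} (p : B ⟶ Z) where
  iter : ∀ {Y : C} (y : Y ⟶ Z) (f : Y ⟶ B ⨿ Y), f ≫ coprod.desc p y = y → (Y ⟶ B)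
  iter_comp : ∀ {Y : C} (y : Y ⟶ Z) (f : Y ⟶ B ⨿ Y) (hf : f ≫ coprod.desc p y = y),
    iter y f hf ≫ p = y
  fixpoint : ∀ {Y : C} (y : Y ⟶ Z) (f : Y ⟶ B ⨿ Y) (hf : f ≫ coprod.desc p y = y),
    iter y f hf = f ≫ coprod.desc (𝟙 B) (iter y f hf)
  uniformity : ∀ {X Y : C} (x : X ⟶ Z) (y : Y ⟶ Z) (f : X ⟶ B ⨿ X) (g : Y ⟶ B ⨿ Y)
    (hf : f ≫ coprod.desc p x = x) (hg : g ≫ coprod.desc p y = y) (h : X ⟶ Y), h ≫ y = x →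
    f ≫ coprod.map (𝟙 B) h = h ≫ g → iter x f hf = h ≫ iter y g hg
  -- The last two side conditions follow from the others; as hypotheses they let the law apply with
  -- whatever proofs are at hand.
  compositionality : ∀ {X Y : C} (x : X ⟶ Z) (y : Y ⟶ Z) (h : Y ⟶ X ⨿ Y) (f : X ⟶ B ⨿ X)
    (_ : h ≫ coprod.desc x y = y) (hf : f ≫ coprod.desc p x = x)
    (hhf : (h ≫ coprod.map (iter x f hf) (𝟙 Y)) ≫ coprod.desc p y = y)
    (hc : (coprod.desc coprod.inl h ≫
      coprod.desc (f ≫ coprod.map (𝟙 B) coprod.inl) (coprod.inr ≫ coprod.inr)) ≫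
        coprod.desc p (coprod.desc x y) = coprod.desc x y),
    iter y (h ≫ coprod.map (iter x f hf) (𝟙 Y)) hhf =
      coprod.inr ≫ iter (coprod.desc x y) (coprod.desc coprod.inl h ≫
        coprod.desc (f ≫ coprod.map (𝟙 B) coprod.inl) (coprod.inr ≫ coprod.inr)) hc

theorem RelElgotAlgebra.iter_congr {Z B : C} {p : B ⟶ Z} (E : RelElgotAlgebra p) {Y : C}
    {y : Y ⟶ Z} {f g : Y ⟶ B ⨿ Y} (h : f = g) (hf : f ≫ coprod.desc p y = y)
    (hg : g ≫ coprod.desc p y = y) : E.iter y f hf = E.iter y g hg := by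
  subst h
  rfl

end Relative

section Distributivity

variable {C : Type u} [Category.{v} C] [CartesianMonoidalCategory C] [FinitaryExtensive C]

theorem prod_coprod_hom_ext {X Y Z W : C} {m m' : X ⊗ (Y ⨿ Z) ⟶ W}
    (h₀ : X ◁ coprod.inl ≫ m = X ◁ coprod.inl ≫ m')
    (h₁ : X ◁ coprod.inr ≫ m = X ◁ coprod.inr ≫ m') : m = m' := by
  rw [← cancel_epi (coprod.desc (X ◁ coprod.inl) (X ◁ coprod.inr) :
    (X ⊗ Y) ⨿ (X ⊗ Z) ⟶ X ⊗ (Y ⨿ Z))]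
  apply coprod.hom_ext
  · rw [← Category.assoc, coprod.inl_desc, h₀, ← Category.assoc, coprod.inl_desc]
  · rw [← Category.assoc, coprod.inr_desc, h₁, ← Category.assoc, coprod.inr_desc]

theorem lift_inl_dstr {X Y Z W : C} (f : W ⟶ X) (g : W ⟶ Y) :
    lift f (g ≫ coprod.inl) ≫ dstr X Y Z = lift f g ≫ coprod.inl := by
  rw [← inl_dstr, lift_whiskerLeft_assoc]

theorem lift_inr_dstr {X Y Z W : C} (f : W ⟶ X) (g : W ⟶ Z) :
    lift f (g ≫ coprod.inr) ≫ dstr X Y Z = lift f g ≫ coprod.inr := by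
  rw [← inr_dstr, lift_whiskerLeft_assoc]

theorem dstr_naturality {X X' : C} (f : X ⟶ X') (Y Z : C) :
    f ▷ (Y ⨿ Z) ≫ dstr X' Y Z = dstr X Y Z ≫ coprod.map (f ▷ Y) (f ▷ Z) := by
  apply prod_coprod_hom_ext
  · rw [whisker_exchange_assoc, inl_dstr, reassoc_of% inl_dstr, coprod.inl_map]
  · rw [whisker_exchange_assoc, inr_dstr, reassoc_of% inr_dstr, coprod.inr_map]

end Distributivity

/-! ### Extending morphisms from `Z × X` to `Z × D X` by iteration -/

section Extension

variable {C : Type u} [Category.{v} C] [CartesianMonoidalCategory C] [FinitaryExtensive C]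
  [HasDelay C]

attribute [local simp] coprod.inl_desc coprod.inr_desc coprod.inl_desc_assoc coprod.inr_desc_assoc

/-- The system of equations over `Z × D X` of which the extension of `k` along
`id × now` is a solution. -/
def delaySystem {Z X W : C} (k : Z ⊗ X ⟶ W) : Z ⊗ D X ⟶ W ⨿ (Z ⊗ D X) :=
  Z ◁ out X ≫ dstr Z X (D X) ≫ coprod.map k (𝟙 _)

theorem now_delaySystem {Z X W : C} (k : Z ⊗ X ⟶ W) :
    Z ◁ now X ≫ delaySystem k = k ≫ coprod.inl := by
  rw [delaySystem, ← MonoidalCategory.whiskerLeft_comp_assoc, now_out, reassoc_of% inl_dstr,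
    coprod.inl_map]

theorem later_delaySystem {Z X W : C} (k : Z ⊗ X ⟶ W) :
    Z ◁ later X ≫ delaySystem k = coprod.inr := by
  rw [delaySystem, ← MonoidalCategory.whiskerLeft_comp_assoc, later_out, reassoc_of% inr_dstr,
    coprod.inr_map, Category.id_comp]

theorem delaySystem_comp {Z X W W' : C} (k : Z ⊗ X ⟶ W) (l : W ⟶ W') :
    delaySystem (k ≫ l) = delaySystem k ≫ coprod.map l (𝟙 _) := by
  simp [delaySystem]

theorem delaySystem_desc {Z X W : C} (k : Z ⊗ X ⟶ W) (w : W ⟶ Z) (hk : k ≫ w = fst Z X) :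
    delaySystem k ≫ coprod.desc w (fst Z (D X)) = fst Z (D X) := by
  apply prod_delay_hom_ext
  · rw [reassoc_of% now_delaySystem, coprod.inl_desc, hk, whiskerLeft_fst]
  · rw [reassoc_of% later_delaySystem, coprod.inr_desc, whiskerLeft_fst]

theorem coit_delaySystem_snd {Z X W : C} (k : X ⟶ W) :
    coit (delaySystem (snd Z X ≫ k)) = snd Z (D X) ≫ mapD k := by
  symm
  apply coit_unique
  apply prod_delay_hom_ext
  · rw [reassoc_of% now_delaySystem, Category.assoc, whiskerLeft_snd_assoc, Category.assoc,
      reassoc_of% now_mapD, now_out, coprod.inl_map, Category.id_comp]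
  · rw [reassoc_of% later_delaySystem, Category.assoc, whiskerLeft_snd_assoc,
      reassoc_of% later_mapD, later_out, coprod.inr_map, Category.assoc]

variable {Z B : C} {p : B ⟶ Z} (E : RelElgotAlgebra p)

namespace RelElgotAlgebra

/-- The iteration-preserving extension of `f : Z × X ⟶ B` to `Z × D X`. -/
def extend {X : C} (f : Z ⊗ X ⟶ B) (hf : f ≫ p = fst Z X) : Z ⊗ D X ⟶ B :=
  E.iter (fst Z (D X)) (delaySystem f) (delaySystem_desc f p hf)

theorem extend_comp {X : C} (f : Z ⊗ X ⟶ B) (hf : f ≫ p = fst Z X) :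
    E.extend f hf ≫ p = fst Z (D X) := E.iter_comp _ _ _

theorem extend_congr {X : C} {f g : Z ⊗ X ⟶ B} (h : f = g) (hf : f ≫ p = fst Z X)
    (hg : g ≫ p = fst Z X) : E.extend f hf = E.extend g hg := by
  subst h
  rfl

theorem now_extend {X : C} (f : Z ⊗ X ⟶ B) (hf : f ≫ p = fst Z X) :
    Z ◁ now X ≫ E.extend f hf = f := by
  rw [extend, E.fixpoint, reassoc_of% now_delaySystem, coprod.inl_desc, Category.comp_id]

theorem later_extend {X : C} (f : Z ⊗ X ⟶ B) (hf : f ≫ p = fst Z X) :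
    Z ◁ later X ≫ E.extend f hf = E.extend f hf := by
  conv_lhs => rw [extend, E.fixpoint, reassoc_of% later_delaySystem, coprod.inr_desc]
  rfl

/-- Compositionality merges `h` and the stepping system into one system on `Z × D X + Y`. Running
`h` and flattening its outcome, paired with `y`, maps this system onto the stepping system alone,
and Uniformity concludes. -/
theorem iter_comp_extend {X Y : C} (f : Z ⊗ X ⟶ B) (hf : f ≫ p = fst Z X) (y : Y ⟶ Z)
    (h : Y ⟶ (Z ⊗ D X) ⨿ Y) (hh : h ≫ coprod.desc (fst Z (D X)) y = y)
    (hhf : (h ≫ coprod.map (E.extend f hf) (𝟙 Y)) ≫ coprod.desc p y = y) :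
    E.iter y (h ≫ coprod.map (E.extend f hf) (𝟙 Y)) hhf =
      lift y (coit (h ≫ coprod.map (snd Z (D X)) (𝟙 Y)) ≫ mult X) ≫ E.extend f hf := by
  have hc : (coprod.desc coprod.inl h ≫ coprod.desc
      (delaySystem f ≫ coprod.map (𝟙 B) coprod.inl) (coprod.inr ≫ coprod.inr)) ≫
        coprod.desc p (coprod.desc (fst Z (D X)) y) = coprod.desc (fst Z (D X)) y := by
    have e : coprod.desc (delaySystem f ≫ coprod.map (𝟙 B) coprod.inl)
        (coprod.inr ≫ coprod.inr) ≫ coprod.desc p (coprod.desc (fst Z (D X)) y) =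
          coprod.desc (fst Z (D X)) y := by
      apply coprod.hom_ext
      · simp [delaySystem_desc f p hf]
      · simp
    rw [Category.assoc, e]
    apply coprod.hom_ext
    · simp
    · simp [hh]
  refine (E.compositionality _ _ h _ hh (delaySystem_desc f p hf) hhf hc).trans ?_
  set c := coit (h ≫ coprod.map (snd Z (D X)) (𝟙 Y)) ≫ mult X with hc'
  -- Flattening costs no step at the junction: when `h` terminates, the inner computation starts at
  -- once.
  have hco : c ≫ out X = h ≫ coprod.desc (snd Z (D X) ≫ out X) (c ≫ coprod.inr) := by
    have e : coprod.map (snd Z (D X)) (𝟙 Y) ≫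
        coprod.map (𝟙 _) (coit (h ≫ coprod.map (snd Z (D X)) (𝟙 Y))) ≫
          coprod.desc (𝟙 (D X) ≫ out X) (kleisli (𝟙 (D X)) ≫ coprod.inr) =
        coprod.desc (snd Z (D X) ≫ out X) (c ≫ coprod.inr) := by
      apply coprod.hom_ext <;> simp [hc', mult]
    rw [← e, hc', Category.assoc, mult, kleisli_out, reassoc_of% coit_out, Category.assoc]
  have hs : lift y c ≫ delaySystem f =
      h ≫ coprod.desc (delaySystem f) (lift y c ≫ coprod.inr) := by
    have e : lift y c ≫ Z ◁ out X =
        h ≫ coprod.desc (Z ◁ out X) (lift y (c ≫ coprod.inr)) := by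
      apply CartesianMonoidalCategory.hom_ext
      · have e₁ : coprod.desc (Z ◁ out X) (lift y (c ≫ coprod.inr)) ≫ fst Z (X ⨿ D X) =
            coprod.desc (fst Z (D X)) y := by
          apply coprod.hom_ext <;> simp
        rw [Category.assoc, Category.assoc, e₁, hh, whiskerLeft_fst, lift_fst]
      · have e₁ : coprod.desc (Z ◁ out X) (lift y (c ≫ coprod.inr)) ≫ snd Z (X ⨿ D X) =
            coprod.desc (snd Z (D X) ≫ out X) (c ≫ coprod.inr) := by
          apply coprod.hom_ext <;> simp
        rw [Category.assoc, Category.assoc, e₁, ← hco, whiskerLeft_snd, lift_snd_assoc]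
    rw [delaySystem, reassoc_of% e]
    congr 1
    apply coprod.hom_ext
    · simp
    · rw [← Category.assoc, coprod.inr_desc, reassoc_of% lift_inr_dstr]
      simp
  have hu := E.uniformity (coprod.desc (fst Z (D X)) y) (fst Z (D X)) _ _ hc
    (delaySystem_desc f p hf) (coprod.desc (𝟙 _) (lift y c))
    (by apply coprod.hom_ext <;> simp)
    (by
      apply coprod.hom_ext
      · simp
      · simp only [Category.assoc, coprod.inr_desc_assoc, hs]
        congr 1
        apply coprod.hom_ext <;> simp)
  rw [hu, ← Category.assoc, coprod.inr_desc]
  rfl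

theorem kleisli_extend {X X' : C} (f : Z ⊗ X ⟶ B) (hf : f ≫ p = fst Z X) (k : X' ⟶ D X)
    (hk : (Z ◁ k ≫ E.extend f hf) ≫ p = fst Z X') :
    Z ◁ kleisli k ≫ E.extend f hf = E.extend (Z ◁ k ≫ E.extend f hf) hk := by
  have hhf : (delaySystem (Z ◁ k) ≫ coprod.map (E.extend f hf) (𝟙 _)) ≫
      coprod.desc p (fst Z (D X')) = fst Z (D X') := by
    rw [← delaySystem_comp, delaySystem_desc _ _ hk]
  refine Eq.symm ((E.iter_congr (delaySystem_comp _ _) _ hhf).trans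
    ((E.iter_comp_extend f hf _ _ (delaySystem_desc _ _ (whiskerLeft_fst _ _)) hhf).trans ?_))
  congr 1
  rw [← delaySystem_comp, whiskerLeft_snd, coit_delaySystem_snd, Category.assoc, mapD_mult]
  ext <;> simp

/-- Since the extension absorbs `later`, both sides are the iteration of the identity starting from
`f`. -/
theorem iota_extend (𝒩 : StableNNO C) {X : C} (f : Z ⊗ X ⟶ B) (hf : f ≫ p = fst Z X) :
    Z ◁ iota 𝒩 X ≫ E.extend f hf = Z ◁ fst X 𝒩.N ≫ f := by
  have e : lift (𝟙 (Z ⊗ X)) (toUnit _ ≫ 𝒩.zero) ≫ (α_ Z X 𝒩.N).hom =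
      Z ◁ lift (𝟙 X) (toUnit X ≫ 𝒩.zero) := by
    ext <;> simp
  rw [← cancel_epi (α_ Z X 𝒩.N).hom]
  trans 𝒩.init f (𝟙 B)
  · apply 𝒩.init_unique
    · rw [reassoc_of% e, ← MonoidalCategory.whiskerLeft_comp_assoc, iota, 𝒩.zero_init, now_extend]
    · rw [associator_naturality_right_assoc, ← MonoidalCategory.whiskerLeft_comp_assoc, iota,
        𝒩.succ_init, MonoidalCategory.whiskerLeft_comp_assoc, later_extend, Category.comp_id]
  · symm
    apply 𝒩.init_unique
    · rw [reassoc_of% e, ← MonoidalCategory.whiskerLeft_comp_assoc, lift_fst,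
        MonoidalCategory.whiskerLeft_id, Category.id_comp]
    · rw [associator_naturality_right_assoc, ← MonoidalCategory.whiskerLeft_comp_assoc,
        whiskerLeft_fst, Category.comp_id]

/-- Both arrows are Kleisli liftings, so each side is the extension of a morphism on `Z × (X × ℕ)`;
these two morphisms agree because the added delays are invisible. -/
theorem extend_condition (𝒩 : StableNNO C) {X : C} (f : Z ⊗ X ⟶ B) (hf : f ≫ p = fst Z X) :
    Z ◁ iotaStar 𝒩 X ≫ E.extend f hf = Z ◁ mapFst 𝒩 X ≫ E.extend f hf := by
  have h₁ : (Z ◁ iota 𝒩 X ≫ E.extend f hf) ≫ p = fst Z (X ⊗ 𝒩.N) := by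
    rw [Category.assoc, extend_comp, whiskerLeft_fst]
  have h₂ : (Z ◁ (fst X 𝒩.N ≫ now X) ≫ E.extend f hf) ≫ p = fst Z (X ⊗ 𝒩.N) := by
    rw [Category.assoc, extend_comp, whiskerLeft_fst]
  refine (E.kleisli_extend f hf _ h₁).trans ((E.extend_congr ?_ h₁ h₂).trans
    (E.kleisli_extend f hf _ h₂).symm)
  rw [iota_extend, MonoidalCategory.whiskerLeft_comp_assoc, now_extend]

end RelElgotAlgebra

end Extension

/-! ### Elgot algebras and search-algebras -/

section SearchElgot

variable {C : Type u} [Category.{v} C] [HasBinaryCoproducts C] [HasDelay C]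

attribute [local simp] coprod.inl_desc coprod.inr_desc coprod.inl_desc_assoc coprod.inr_desc_assoc

theorem coit_comp_fixpoint {A Y : C} {a : D A ⟶ A} (ha : IsSearchAlgebra a) (f : Y ⟶ A ⨿ Y) :
    coit f ≫ a = f ≫ coprod.desc (𝟙 A) (coit f ≫ a) := by
  have e : coprod.map (𝟙 A) (coit f) ≫ coprod.desc (now A) (later A) ≫ a =
      coprod.desc (𝟙 A) (coit f ≫ a) := by
    apply coprod.hom_ext <;> simp [ha.now, ha.later]
  rw [← e, ← reassoc_of% coit_out, reassoc_of% out_inv_now_later]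

/-- Running `h` and then `f` on its outcome, copaired with running `f`, is a coalgebra morphism out
of the merged system on `X + Y`. -/
theorem coit_kleisli_coit {A X Y : C} (h : Y ⟶ X ⨿ Y) (f : X ⟶ A ⨿ X) :
    coit h ≫ kleisli (coit f) = coprod.inr ≫ coit (coprod.desc coprod.inl h ≫
      coprod.desc (f ≫ coprod.map (𝟙 A) coprod.inl) (coprod.inr ≫ coprod.inr)) := by
  have key : coprod.desc (coit f) (coit h ≫ kleisli (coit f)) =
      coit (coprod.desc coprod.inl h ≫
        coprod.desc (f ≫ coprod.map (𝟙 A) coprod.inl) (coprod.inr ≫ coprod.inr)) := by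
    apply coit_unique
    apply coprod.hom_ext
    · simp [coit_out]
    · have e : coprod.map (𝟙 X) (coit h) ≫
          coprod.desc (coit f ≫ out A) (kleisli (coit f) ≫ coprod.inr) =
            coprod.desc (f ≫ coprod.map (𝟙 A) coprod.inl) (coprod.inr ≫ coprod.inr) ≫
              coprod.map (𝟙 A) (coprod.desc (coit f) (coit h ≫ kleisli (coit f))) := by
        apply coprod.hom_ext <;> simp [coit_out]
      simp only [coprod.inr_desc_assoc, Category.assoc, ← e]
      rw [kleisli_out, reassoc_of% coit_out]
  rw [← key, coprod.inr_desc]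

/-- The Elgot algebra of a search-algebra which is an Eilenberg-Moore algebra. -/
def elgotOfSearchAlgebra {A : C} {a : D A ⟶ A} (ha : IsSearchAlgebra a)
    (hm : mult A ≫ a = mapD a ≫ a) : ElgotAlgebra A where
  iter f := coit f ≫ a
  fixpoint f := coit_comp_fixpoint ha f
  uniformity f g h w := by rw [← comp_coit h w, Category.assoc]
  -- Only this law uses the Eilenberg-Moore condition: evaluating the outcomes of `h` first is the
  -- same as flattening first.
  compositionality h f := by
    rw [← coit_mapD, mapD_comp, Category.assoc, Category.assoc, ← hm, reassoc_of% mapD_mult,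
      reassoc_of% coit_kleisli_coit]

theorem ElgotAlgebra.isSearchAlgebra_iter_out {A : C} (E : ElgotAlgebra A) :
    IsSearchAlgebra (E.iter (out A)) where
  now := by rw [E.fixpoint, ← Category.assoc, now_out, coprod.inl_desc]
  later := by
    conv_lhs => rw [E.fixpoint, ← Category.assoc, later_out, coprod.inr_desc]

end SearchElgot

/-! ### Freeness of the quotient relative to a base -/

section RelativelyFree

variable {C : Type u} [Category.{v} C] [CartesianMonoidalCategory C] [FinitaryExtensive C]

attribute [local simp] coprod.inl_desc coprod.inr_desc coprod.inl_desc_assoc coprod.inr_desc_assoc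

/-- The system `k : Y ⟶ Z × A + Y` with the outcomes in `A` replaced by a parameter in `Q`. -/
def constSystem {Z A Y : C} (k : Y ⟶ (Z ⊗ A) ⨿ Y) (Q : C) : Q ⊗ Y ⟶ (Z ⊗ Q) ⨿ (Q ⊗ Y) :=
  Q ◁ k ≫ dstr Q (Z ⊗ A) Y ≫ coprod.map (lift (snd _ _ ≫ fst _ _) (fst _ _)) (𝟙 _)

theorem constSystem_naturality {Z A Y Q Q' : C} (k : Y ⟶ (Z ⊗ A) ⨿ Y) (r : Q ⟶ Q') :
    r ▷ Y ≫ constSystem k Q' = constSystem k Q ≫ coprod.map (Z ◁ r) (r ▷ Y) := by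
  have e : r ▷ (Z ⊗ A) ≫ lift (snd _ _ ≫ fst _ _) (fst _ _) =
      lift (snd _ _ ≫ fst _ _) (fst _ _) ≫ Z ◁ r := by
    ext <;> simp
  rw [constSystem, constSystem, ← whisker_exchange_assoc, reassoc_of% dstr_naturality]
  simp only [Category.assoc, coprod.map_map, e, Category.id_comp, Category.comp_id]

theorem constSystem_desc {Z A Y : C} (k : Y ⟶ (Z ⊗ A) ⨿ Y) (y : Y ⟶ Z)
    (hk : k ≫ coprod.desc (fst Z A) y = y) (Q : C) :
    constSystem k Q ≫ coprod.desc (fst Z Q) (snd Q Y ≫ y) = snd Q Y ≫ y := by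
  have e : dstr Q (Z ⊗ A) Y ≫ coprod.map (lift (snd _ _ ≫ fst _ _) (fst _ _)) (𝟙 _) ≫
      coprod.desc (fst Z Q) (snd Q Y ≫ y) = snd _ _ ≫ coprod.desc (fst Z A) y := by
    apply prod_coprod_hom_ext
    · rw [reassoc_of% inl_dstr]
      simp
    · rw [reassoc_of% inr_dstr]
      simp
  rw [constSystem, Category.assoc, Category.assoc, e, whiskerLeft_snd_assoc, hk]

/-- The value `a` is constant along a run and equals its outcome, so replacing the outcome by `a`
changes nothing: `⟨a, id⟩` is a morphism of systems. -/
theorem lift_constSystem {Z A Y : C} (k : Y ⟶ (Z ⊗ A) ⨿ Y) (a : Y ⟶ A)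
    (ha : a = k ≫ coprod.desc (snd Z A) a) :
    lift a (𝟙 Y) ≫ constSystem k A = k ≫ coprod.map (𝟙 _) (lift a (𝟙 Y)) := by
  have e₀ : lift a (𝟙 Y) ≫ A ◁ k = k ≫ lift (coprod.desc (snd Z A) a) (𝟙 _) := by
    ext
    · simp [← ha]
    · simp
  have e₁ : lift (coprod.desc (snd Z A) a) (𝟙 _) ≫ dstr A (Z ⊗ A) Y =
      coprod.map (lift (snd _ _) (𝟙 _)) (lift a (𝟙 Y)) := by
    apply coprod.hom_ext
    · have : coprod.inl ≫ lift (coprod.desc (snd Z A) a) (𝟙 ((Z ⊗ A) ⨿ Y)) =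
          lift (snd Z A) (𝟙 _ ≫ coprod.inl) := by
        ext <;> simp
      rw [← Category.assoc, this, lift_inl_dstr, coprod.inl_map]
    · have : coprod.inr ≫ lift (coprod.desc (snd Z A) a) (𝟙 ((Z ⊗ A) ⨿ Y)) =
          lift a (𝟙 _ ≫ coprod.inr) := by
        ext <;> simp
      rw [← Category.assoc, this, lift_inr_dstr, coprod.inr_map]
  have e₂ : lift (snd Z A) (𝟙 _) ≫ lift (snd A (Z ⊗ A) ≫ fst _ _) (fst _ _) = 𝟙 _ := by
    ext <;> simp
  rw [constSystem, reassoc_of% e₀, reassoc_of% e₁, coprod.map_map, e₂, Category.comp_id]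

variable [HasDelay C]

/-- Preservation of iteration by a morphism over `Z` from `Z × A`, where `A` is a
search-algebra, to an Elgot algebra over `Z`. -/
def RelElgotAlgebra.PreservesIter {Z B : C} {p : B ⟶ Z} (E : RelElgotAlgebra p) {A : C}
    (a : D A ⟶ A) (h : Z ⊗ A ⟶ B) : Prop :=
  ∀ {Y : C} (y : Y ⟶ Z) (k : Y ⟶ (Z ⊗ A) ⨿ Y) (_ : k ≫ coprod.desc (fst Z A) y = y)
    (hk : (k ≫ coprod.map h (𝟙 Y)) ≫ coprod.desc p y = y),
    lift y (coit (k ≫ coprod.map (snd Z A) (𝟙 Y)) ≫ a) ≫ h =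
      E.iter y (k ≫ coprod.map h (𝟙 Y)) hk

variable {𝒩 : StableNNO C} [HasDelayQuotient 𝒩]
  (hp : ∀ X Y : C, PreservesColimit (parallelPair (iotaStar 𝒩 Y) (mapFst 𝒩 Y)) (tensorLeft X))
  {X : C} {α : D (Dtilde 𝒩 X) ⟶ Dtilde 𝒩 X}
  (hρ : IsDAlgebraMorphism (mult X) α (rho 𝒩 X))

include hρ

theorem mapD_now_rho_comp : mapD (now X ≫ rho 𝒩 X) ≫ α = rho 𝒩 X := by
  have hρ' : mult X ≫ rho 𝒩 X = mapD (rho 𝒩 X) ≫ α := hρ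
  have e : mapD (now X) ≫ mult X = 𝟙 _ := by rw [mapD_mult, kleisli_now]
  rw [mapD_comp, Category.assoc, ← hρ', reassoc_of% e]

include hp

variable (hα : IsSearchAlgebra α)
  {Z B : C} {p : B ⟶ Z} (E : RelElgotAlgebra p)

namespace RelElgotAlgebra

include hα in
-- The outcomes of `k` lie in `Dtilde X` and need not lift along `ρ`. A parameter replacing them can
-- be lifted, because `ρ × Y` is epic; this is what `constSystem` is for.
theorem preservesIter_of_rho_comp_eq_extend (f : Z ⊗ X ⟶ B) (hf : f ≫ p = fst Z X)
    (h : Z ⊗ Dtilde 𝒩 X ⟶ B) (hh : Z ◁ rho 𝒩 X ≫ h = E.extend f hf) :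
    E.PreservesIter α h := by
  have hρ' : mult X ≫ rho 𝒩 X = mapD (rho 𝒩 X) ≫ α := hρ
  intro Y y k hk hk'
  have hhp : h ≫ p = fst Z _ := by
    apply whiskerLeft_rho_hom_ext hp
    rw [reassoc_of% hh, extend_comp, whiskerLeft_fst]
  have w : ∀ {Q : C} (g : Z ⊗ Q ⟶ B), g ≫ p = fst Z Q →
      (constSystem k Q ≫ coprod.map g (𝟙 _)) ≫ coprod.desc p (snd Q Y ≫ y) = snd Q Y ≫ y := by
    intro Q g hg
    rw [Category.assoc, coprod.map_desc, hg, Category.id_comp, constSystem_desc k y hk]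
  have key : lift (snd _ Y ≫ y)
      (coit (constSystem k (Dtilde 𝒩 X) ≫ coprod.map (snd Z _) (𝟙 _)) ≫ α) ≫ h =
        E.iter (snd _ Y ≫ y) (constSystem k (Dtilde 𝒩 X) ≫ coprod.map h (𝟙 _)) (w h hhp) := by
    -- With the parameter in `D X`, the system takes its outcomes in `Z × D X`, where
    -- `iter_comp_extend` applies.
    apply whiskerRight_rho_hom_ext hp
    have hu := E.uniformity (snd (D X) Y ≫ y) (snd (Dtilde 𝒩 X) Y ≫ y) _ _
      (w (E.extend f hf) (E.extend_comp f hf)) (w h hhp) (rho 𝒩 X ▷ Y) (by simp) (by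
        rw [reassoc_of% constSystem_naturality, Category.assoc, coprod.map_map, coprod.map_map,
          hh, Category.comp_id, Category.id_comp, Category.comp_id])
    rw [← hu, iter_comp_extend _ _ _ _ _ (constSystem_desc k y hk (D X)), ← hh]
    have hc : rho 𝒩 X ▷ Y ≫ coit (constSystem k (Dtilde 𝒩 X) ≫ coprod.map (snd Z _) (𝟙 _)) =
        coit (constSystem k (D X) ≫ coprod.map (snd Z _) (𝟙 _)) ≫ mapD (rho 𝒩 X) := by
      rw [coit_mapD]
      apply comp_coit
      rw [reassoc_of% constSystem_naturality]
      simp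
    rw [← Category.assoc, ← Category.assoc]
    congr 1
    ext
    · simp
    · simp only [Category.assoc, lift_snd, whiskerLeft_snd, lift_snd_assoc]
      rw [reassoc_of% hc, ← hρ']
  -- The parameter is now specialized to the solution of `k` itself.
  have ht := lift_constSystem k (coit (k ≫ coprod.map (snd Z _) (𝟙 Y)) ≫ α) (by
    conv_lhs => rw [coit_comp_fixpoint hα]
    simp)
  rw [E.uniformity y (snd _ Y ≫ y) _ _ hk' (w h hhp) (lift _ (𝟙 Y)) (by simp) (by
    rw [reassoc_of% ht]
    simp), ← key, ← Category.assoc]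
  congr 1
  ext
  · simp
  · simp only [lift_snd, comp_lift]
    rw [← Category.assoc (lift _ _)]
    congr 1
    symm
    apply comp_coit
    rw [reassoc_of% ht]
    simp

include hα in
theorem existsUnique_extension (f : Z ⊗ X ⟶ B) (hf : f ≫ p = fst Z X) :
    ∃! h : Z ⊗ Dtilde 𝒩 X ⟶ B, h ≫ p = fst Z _ ∧ E.PreservesIter α h ∧
      Z ◁ (now X ≫ rho 𝒩 X) ≫ h = f := by
  obtain ⟨h, hh⟩ := exists_whiskerLeft_rho_comp_eq hp _ (E.extend_condition 𝒩 f hf)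
  refine ⟨h, ⟨?_, E.preservesIter_of_rho_comp_eq_extend hp hρ hα f hf h hh, ?_⟩, ?_⟩
  · apply whiskerLeft_rho_hom_ext hp
    rw [reassoc_of% hh, extend_comp, whiskerLeft_fst]
  · rw [MonoidalCategory.whiskerLeft_comp_assoc, hh, now_extend]
  · rintro h' ⟨h'p, h'i, h'f⟩
    apply whiskerLeft_rho_hom_ext hp
    have hs : delaySystem (Z ◁ (now X ≫ rho 𝒩 X)) ≫ coprod.map h' (𝟙 _) = delaySystem f := by
      rw [← delaySystem_comp, h'f]
    have hd : (delaySystem (Z ◁ (now X ≫ rho 𝒩 X)) ≫ coprod.map h' (𝟙 _)) ≫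
        coprod.desc p (fst Z (D X)) = fst Z (D X) := by
      rw [hs, delaySystem_desc f p hf]
    -- On `Z × D X`, the morphism `id × ρ` is itself the solution of the stepping system with
    -- outcomes embedded by the unit, so preservation of iteration forces the value of `h'` there.
    have := h'i _ _ (delaySystem_desc _ _ (whiskerLeft_fst _ _)) hd
    rw [← delaySystem_comp, whiskerLeft_snd, coit_delaySystem_snd, Category.assoc,
      mapD_now_rho_comp hρ] at this
    rw [hh, extend, ← E.iter_congr hs hd, ← this]
    congr 1
    ext <;> simp

end RelElgotAlgebra

end RelativelyFree

/-! ### Coproducts in the slice category and in `C` -/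

section OverCoproduct

variable {C : Type u} [Category.{v} C] [HasBinaryCoproducts C]

/-- The comparison morphism from the coproduct in `C` to (the domain of) the coproduct
in the slice category. -/
def toOverCoprod {Z : C} (P Q : Over Z) : P.left ⨿ Q.left ⟶ (P ⨿ Q : Over Z).left :=
  coprod.desc (coprod.inl : P ⟶ P ⨿ Q).left (coprod.inr : Q ⟶ P ⨿ Q).left

theorem inl_toOverCoprod {Z : C} (P Q : Over Z) :
    coprod.inl ≫ toOverCoprod P Q = (coprod.inl : P ⟶ P ⨿ Q).left := coprod.inl_desc _ _

theorem inr_toOverCoprod {Z : C} (P Q : Over Z) :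
    coprod.inr ≫ toOverCoprod P Q = (coprod.inr : Q ⟶ P ⨿ Q).left := coprod.inr_desc _ _

theorem toOverCoprod_hom {Z : C} (P Q : Over Z) :
    toOverCoprod P Q ≫ (P ⨿ Q : Over Z).hom = coprod.desc P.hom Q.hom := by
  apply coprod.hom_ext
  · rw [reassoc_of% inl_toOverCoprod, Over.w, coprod.inl_desc]
  · rw [reassoc_of% inr_toOverCoprod, Over.w, coprod.inr_desc]

theorem toOverCoprod_desc {Z : C} {P Q R : Over Z} (f : P ⟶ R) (g : Q ⟶ R) :
    toOverCoprod P Q ≫ (coprod.desc f g).left = coprod.desc f.left g.left := by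
  apply coprod.hom_ext
  · rw [reassoc_of% inl_toOverCoprod, ← Over.comp_left, coprod.inl_desc, coprod.inl_desc]
  · rw [reassoc_of% inr_toOverCoprod, ← Over.comp_left, coprod.inr_desc, coprod.inr_desc]

theorem toOverCoprod_map {Z : C} {P Q P' Q' : Over Z} (f : P ⟶ P') (g : Q ⟶ Q') :
    toOverCoprod P Q ≫ (coprod.map f g).left =
      coprod.map f.left g.left ≫ toOverCoprod P' Q' := by
  apply coprod.hom_ext
  · rw [reassoc_of% inl_toOverCoprod, ← Over.comp_left, coprod.inl_map, ← Category.assoc,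
      coprod.inl_map, Category.assoc, inl_toOverCoprod, Over.comp_left]
  · rw [reassoc_of% inr_toOverCoprod, ← Over.comp_left, coprod.inr_map, ← Category.assoc,
      coprod.inr_map, Category.assoc, inr_toOverCoprod, Over.comp_left]

/-- The morphism over `Z` given by a morphism into a coproduct in `C`. -/
def overSystem {Z : C} {P Q Y : Over Z} (f : Y.left ⟶ P.left ⨿ Q.left)
    (hf : f ≫ coprod.desc P.hom Q.hom = Y.hom) : Y ⟶ P ⨿ Q :=
  Over.homMk (f ≫ toOverCoprod P Q) (by rw [Category.assoc, toOverCoprod_hom, hf])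

theorem overSystem_left {Z : C} {P Q Y : Over Z} (f : Y.left ⟶ P.left ⨿ Q.left)
    (hf : f ≫ coprod.desc P.hom Q.hom = Y.hom) :
    (overSystem f hf).left = f ≫ toOverCoprod P Q := rfl

theorem overSystem_map {Z : C} {P Q P' Q' Y : Over Z} (f : Y.left ⟶ P.left ⨿ Q.left)
    (hf : f ≫ coprod.desc P.hom Q.hom = Y.hom) (g : P ⟶ P') (h : Q ⟶ Q')
    (hf' : (f ≫ coprod.map g.left h.left) ≫ coprod.desc P'.hom Q'.hom = Y.hom) :
    overSystem f hf ≫ coprod.map g h = overSystem (f ≫ coprod.map g.left h.left) hf' := by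
  ext
  rw [Over.comp_left, overSystem_left, overSystem_left, Category.assoc, Category.assoc,
    toOverCoprod_map]

namespace ElgotAlgebra

variable {Z : C} {B : Over Z} (E : ElgotAlgebra B)

theorem iter_overSystem_fixpoint {Y : Over Z} (f : Y.left ⟶ B.left ⨿ Y.left)
    (hf : f ≫ coprod.desc B.hom Y.hom = Y.hom) :
    (E.iter (overSystem f hf)).left =
      f ≫ coprod.desc (𝟙 B.left) (E.iter (overSystem f hf)).left := by
  conv_lhs => rw [E.fixpoint, Over.comp_left, overSystem_left, Category.assoc,
    toOverCoprod_desc, Over.id_left]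

theorem iter_overSystem_uniformity {X Y : Over Z} (f : X.left ⟶ B.left ⨿ X.left)
    (g : Y.left ⟶ B.left ⨿ Y.left) (hf : f ≫ coprod.desc B.hom X.hom = X.hom)
    (hg : g ≫ coprod.desc B.hom Y.hom = Y.hom) (h : X ⟶ Y)
    (e : f ≫ coprod.map (𝟙 B.left) h.left = h.left ≫ g) :
    (E.iter (overSystem f hf)).left = h.left ≫ (E.iter (overSystem g hg)).left := by
  rw [← Over.comp_left, E.uniformity (overSystem f hf) (overSystem g hg) h]
  ext
  rw [Over.comp_left, Over.comp_left, overSystem_left, overSystem_left, Category.assoc,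
    toOverCoprod_map, Over.id_left, reassoc_of% e]

end ElgotAlgebra

end OverCoproduct

/-! ### Translation between Elgot algebras in `C/Z` and relative ones -/

section OverSlice

variable {C : Type u} [Category.{v} C] [CartesianMonoidalCategory C] [HasBinaryCoproducts C]

attribute [local simp] coprod.inl_desc coprod.inr_desc coprod.inl_desc_assoc coprod.inr_desc_assoc

theorem toOverCoprod_overDesc {Z R : C} (P Q : Over Z) (f : P.left ⟶ R) (g : Q.left ⟶ R) :
    toOverCoprod P Q ≫ overDesc f g = coprod.desc f g := by
  apply coprod.hom_ext
  · rw [reassoc_of% inl_toOverCoprod, inl_overDesc, coprod.inl_desc]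
  · rw [reassoc_of% inr_toOverCoprod, inr_overDesc, coprod.inr_desc]

/-- One half of the statement that the comparison of coproducts is invertible; hence every system in
the slice comes from one in `C`. -/
theorem overDesc_toOverCoprod {Z : C} (P Q : Over Z) :
    overDesc coprod.inl coprod.inr ≫ toOverCoprod P Q = 𝟙 _ := by
  apply over_coprod_hom_ext
  · rw [inl_overDesc_assoc, inl_toOverCoprod, Category.comp_id]
  · rw [inr_overDesc_assoc, inr_toOverCoprod, Category.comp_id]

theorem left_overDesc_desc {Z : C} {P Q Y : Over Z} (K : Y ⟶ P ⨿ Q) :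
    (K.left ≫ overDesc coprod.inl coprod.inr) ≫ coprod.desc P.hom Q.hom = Y.hom := by
  rw [← toOverCoprod_hom, Category.assoc, ← Category.assoc (overDesc _ _), overDesc_toOverCoprod,
    Category.id_comp, Over.w]

theorem overSystem_left_overDesc {Z : C} {P Q Y : Over Z} (K : Y ⟶ P ⨿ Q) :
    overSystem (K.left ≫ overDesc coprod.inl coprod.inr) (left_overDesc_desc K) = K := by
  ext
  rw [overSystem_left, Category.assoc, overDesc_toOverCoprod, Category.comp_id]

namespace ElgotAlgebra

variable {Z : C} {B : Over Z} (E : ElgotAlgebra B)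

/-- Compositionality in the slice produces a system carried by the slice coproduct of `X` and `Y`.
Uniformity along the comparison morphism moves it to the coproduct of `C`. -/
theorem iter_overSystem_compositionality {X Y : Over Z} (h : Y.left ⟶ X.left ⨿ Y.left)
    (f : X.left ⟶ B.left ⨿ X.left) (hh : h ≫ coprod.desc X.hom Y.hom = Y.hom)
    (hf : f ≫ coprod.desc B.hom X.hom = X.hom)
    (hhf : (h ≫ coprod.map (E.iter (overSystem f hf)).left (𝟙 Y.left)) ≫
      coprod.desc B.hom Y.hom = Y.hom)
    (hc : (coprod.desc coprod.inl h ≫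
      coprod.desc (f ≫ coprod.map (𝟙 B.left) coprod.inl) (coprod.inr ≫ coprod.inr)) ≫
        coprod.desc B.hom (coprod.desc X.hom Y.hom) = coprod.desc X.hom Y.hom) :
    (E.iter (overSystem (h ≫ coprod.map (E.iter (overSystem f hf)).left (𝟙 Y.left)) hhf)).left =
      coprod.inr ≫ (E.iter (overSystem (Y := Over.mk (coprod.desc X.hom Y.hom))
        (Q := Over.mk (coprod.desc X.hom Y.hom)) (coprod.desc coprod.inl h ≫
          coprod.desc (f ≫ coprod.map (𝟙 B.left) coprod.inl) (coprod.inr ≫ coprod.inr)) hc)).left := by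
  have hcomp := E.compositionality (overSystem h hh) (overSystem f hf)
  rw [overSystem_map h hh (E.iter (overSystem f hf)) (𝟙 Y) hhf] at hcomp
  refine (congrArg (fun k => k.left) hcomp).trans ?_
  rw [Over.comp_left, ← inr_toOverCoprod, Category.assoc]
  congr 1
  set S := coprod.desc coprod.inl (overSystem h hh) ≫
    coprod.desc (overSystem f hf ≫ coprod.map (𝟙 B) coprod.inl) (coprod.inr ≫ coprod.inr) with hS
  have hiter : (E.iter S).left =
      (E.iter (overSystem (S.left ≫ overDesc coprod.inl coprod.inr) (left_overDesc_desc S))).left := by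
    rw [overSystem_left_overDesc]
  have e₁ : (coprod.inr : (X ⨿ Y : Over Z) ⟶ B ⨿ (X ⨿ Y)).left ≫
      overDesc coprod.inl coprod.inr = coprod.inr := inr_overDesc _ _
  have e₂ : ∀ {P Q : Over Z} (g : P ⟶ Q), (coprod.map (𝟙 B) g).left ≫
      overDesc coprod.inl coprod.inr =
        overDesc coprod.inl coprod.inr ≫ coprod.map (𝟙 B.left) g.left := by
    intro P Q g
    apply over_coprod_hom_ext
    · rw [over_inl_map_left, inl_overDesc, inl_overDesc_assoc, coprod.inl_map, Over.id_left]
    · rw [over_inr_map_left, inr_overDesc, inr_overDesc_assoc, coprod.inr_map]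
  have e₃ : ∀ {P : Over Z}, toOverCoprod B P ≫ overDesc coprod.inl coprod.inr = 𝟙 _ := by
    intro P
    rw [toOverCoprod_overDesc]
    apply coprod.hom_ext <;> simp
  have e : (coprod.desc coprod.inl h ≫
      coprod.desc (f ≫ coprod.map (𝟙 B.left) coprod.inl) (coprod.inr ≫ coprod.inr)) ≫
        coprod.map (𝟙 B.left) (toOverCoprod X Y) =
      toOverCoprod X Y ≫ S.left ≫ overDesc coprod.inl coprod.inr := by
    have e₄ : toOverCoprod X Y ≫ (coprod.desc (coprod.inl : X ⟶ X ⨿ Y) (overSystem h hh)).left =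
        coprod.desc coprod.inl h ≫ toOverCoprod X Y := by
      rw [toOverCoprod_desc]
      apply coprod.hom_ext
      · rw [coprod.inl_desc, ← Category.assoc, coprod.inl_desc, inl_toOverCoprod]
      · rw [coprod.inr_desc, ← Category.assoc, coprod.inr_desc, overSystem_left]
    rw [hS, Over.comp_left]
    simp only [Category.assoc]
    rw [reassoc_of% e₄]
    congr 1
    rw [← Category.assoc (toOverCoprod X Y), toOverCoprod_desc]
    apply coprod.hom_ext
    · rw [← Category.assoc, coprod.inl_desc, ← Category.assoc, coprod.inl_desc, Over.comp_left,
        overSystem_left, Category.assoc, Category.assoc, Category.assoc, e₂, reassoc_of% e₃,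
        coprod.map_map, inl_toOverCoprod, Category.id_comp]
    · rw [← Category.assoc, coprod.inr_desc, ← Category.assoc, coprod.inr_desc, Over.comp_left,
        Category.assoc, Category.assoc, e₁, coprod.inr_map, reassoc_of% inr_toOverCoprod]
  rw [hiter]
  exact (E.iter_overSystem_uniformity (X := Over.mk (coprod.desc X.hom Y.hom)) (Y := X ⨿ Y) _ _
    hc (left_overDesc_desc S) (Over.homMk (toOverCoprod X Y) (toOverCoprod_hom _ _)) e).symm

/-- An Elgot algebra in the slice category over `Z`, expressed by means of the coproducts of the
ambient category. -/
def toRel : RelElgotAlgebra B.hom where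
  iter y f hf := (E.iter (overSystem (Y := Over.mk y) (Q := Over.mk y) f hf)).left
  iter_comp y f hf := Over.w (E.iter (overSystem (Y := Over.mk y) (Q := Over.mk y) f hf))
  fixpoint y f hf := E.iter_overSystem_fixpoint (Y := Over.mk y) f hf
  uniformity x y f g hf hg h w e := E.iter_overSystem_uniformity (X := Over.mk x)
    (Y := Over.mk y) f g hf hg (Over.homMk h w) e
  compositionality x y h f hh hf hhf hc :=
    E.iter_overSystem_compositionality (X := Over.mk x) (Y := Over.mk y) h f hh hf hhf hc

theorem slice_iter_overSystem_left {Z A : C} (E : ElgotAlgebra A) {Y : Over Z}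
    (f : Y.left ⟶ (Z ⊗ A) ⨿ Y.left)
    (hf : f ≫ coprod.desc (fst Z A) Y.hom = Y.hom) :
    ((E.slice Z).iter (overSystem (P := Over.mk (fst Z A)) f hf)).left =
      lift Y.hom (E.iter (f ≫ coprod.map (snd Z A) (𝟙 _))) := by
  have e : (f ≫ toOverCoprod (Over.mk (fst Z A)) Y) ≫
      overDesc (snd Z A ≫ coprod.inl) coprod.inr = f ≫ coprod.map (snd Z A) (𝟙 _) := by
    rw [Category.assoc, toOverCoprod_overDesc]
    congr 1
    apply coprod.hom_ext <;> simp
  change lift Y.hom (E.iter ((f ≫ toOverCoprod (Over.mk (fst Z A)) Y) ≫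
    overDesc (snd Z A ≫ coprod.inl) coprod.inr)) = _
  rw [e]

theorem slice_iterationPreserving_iff {Z A : C} (E : ElgotAlgebra A) {B : Over Z}
    (E' : ElgotAlgebra B) (h : Over.mk (fst Z A) ⟶ B) :
    (E.slice Z).IterationPreserving E' h ↔
      ∀ {Y : C} (y : Y ⟶ Z) (k : Y ⟶ (Z ⊗ A) ⨿ Y) (_ : k ≫ coprod.desc (fst Z A) y = y)
        (hk : (k ≫ coprod.map h.left (𝟙 Y)) ≫ coprod.desc B.hom y = y),
        lift y (E.iter (k ≫ coprod.map (snd Z A) (𝟙 Y))) ≫ h.left =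
          E'.toRel.iter y (k ≫ coprod.map h.left (𝟙 Y)) hk := by
  constructor
  · intro H Y y k hk hk'
    have H' := congrArg (fun m => m.left) (H (X := Over.mk y)
      (overSystem (P := Over.mk (fst Z A)) (Q := Over.mk y) (Y := Over.mk y) k hk))
    rw [Over.comp_left, slice_iter_overSystem_left,
      overSystem_map (P := Over.mk (fst Z A)) (Y := Over.mk y) (Q := Over.mk y)
        (Q' := Over.mk y) k hk h (𝟙 _) hk'] at H'
    exact H'
  · intro H Y K
    have hK := left_overDesc_desc K
    rw [← overSystem_left_overDesc K]
    set k := K.left ≫ overDesc coprod.inl coprod.inr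
    have hk' : (k ≫ coprod.map h.left (𝟙 Y.left)) ≫ coprod.desc B.hom Y.hom = Y.hom := by
      rw [Category.assoc, coprod.map_desc, Over.w, Category.id_comp, hK]
    ext
    rw [overSystem_map k hK h (𝟙 Y) hk', Over.comp_left, slice_iter_overSystem_left]
    exact H Y.hom k hK hk'

theorem slice_unit_iterationPreserving_iff {A B : C} (E : ElgotAlgebra A) (E' : ElgotAlgebra B)
    (h : A ⟶ B) :
    (E.slice (𝟙_ C)).IterationPreserving (E'.slice (𝟙_ C))
      (Over.homMk (𝟙_ C ◁ h) : Over.mk (fst (𝟙_ C) A) ⟶ Over.mk (fst (𝟙_ C) B)) ↔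
      E.IterationPreserving E' h := by
  rw [slice_iterationPreserving_iff]
  have key : ∀ {Y : C} (y : Y ⟶ 𝟙_ C) (k : Y ⟶ (𝟙_ C ⊗ A) ⨿ Y)
      (hk : (k ≫ coprod.map (𝟙_ C ◁ h) (𝟙 Y)) ≫ coprod.desc (fst (𝟙_ C) B) y = y),
      (E'.slice (𝟙_ C)).toRel.iter y (k ≫ coprod.map (𝟙_ C ◁ h) (𝟙 Y)) hk =
        lift y (E'.iter ((k ≫ coprod.map (snd _ _) (𝟙 Y)) ≫ coprod.map h (𝟙 Y))) := by
    intro Y y k hk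
    refine (E'.slice_iter_overSystem_left (Y := Over.mk y) _ hk).trans ?_
    change lift y _ = _
    rw [Category.assoc, Category.assoc, coprod.map_map, coprod.map_map, whiskerLeft_snd]
    rfl
  constructor
  · intro H Y k
    have hk : ∀ w : Y ⟶ 𝟙_ C, w = toUnit Y := fun w => toUnit_unique _ _
    have := (H (toUnit Y) (k ≫ coprod.map (lift (toUnit A) (𝟙 A)) (𝟙 Y)) (hk _) (hk _)).trans
      (key _ _ (hk _))
    replace this := congrArg (fun m => m ≫ snd _ _) this
    have e : (k ≫ coprod.map (lift (toUnit A) (𝟙 A)) (𝟙 Y)) ≫ coprod.map (snd _ _) (𝟙 Y) = k := by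
      rw [Category.assoc, coprod.map_map, lift_snd, Category.id_comp, coprod.map_id_id,
        Category.comp_id]
    rw [e] at this
    change (lift (toUnit Y) (E.iter k) ≫ 𝟙_ C ◁ h) ≫ snd _ _ = lift _ _ ≫ snd _ _ at this
    rwa [Category.assoc, whiskerLeft_snd, lift_snd_assoc, lift_snd] at this
  · intro H Y y k hk hk'
    refine Eq.trans ?_ (key y k hk').symm
    change lift y _ ≫ 𝟙_ C ◁ h = _
    rw [← H]
    apply CartesianMonoidalCategory.hom_ext
    · exact toUnit_unique _ _
    · rw [Category.assoc, whiskerLeft_snd, lift_snd_assoc, lift_snd]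

/-- The slice over the terminal object is `C` up to equivalence: being over it is no condition, and
every morphism `1 × A ⟶ 1 × B` has the form `id × k₀`. -/
theorem isFree_of_slice_unit {X A : C} (E : ElgotAlgebra A) (η : X ⟶ A)
    (h : (E.slice (𝟙_ C)).IsFree
      (Over.homMk (𝟙_ C ◁ η) : Over.mk (fst (𝟙_ C) X) ⟶ Over.mk (fst (𝟙_ C) A))) :
    E.IsFree η := by
  intro B E' f
  obtain ⟨k, ⟨hk₁, hk₂⟩, hk₃⟩ := h (E'.slice (𝟙_ C))
    (Over.homMk (𝟙_ C ◁ f) : Over.mk (fst (𝟙_ C) X) ⟶ Over.mk (fst (𝟙_ C) B))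
  obtain ⟨k₀, rfl⟩ : ∃ k₀ : A ⟶ B, k = Over.homMk (𝟙_ C ◁ k₀) := by
    refine ⟨lift (toUnit A) (𝟙 A) ≫ k.left ≫ snd _ _, ?_⟩
    ext
    apply CartesianMonoidalCategory.hom_ext
    · exact toUnit_unique _ _
    · have : snd (𝟙_ C) A ≫ lift (toUnit A) (𝟙 A) = 𝟙 _ := by
        ext
        simp
      change _ = 𝟙_ C ◁ _ ≫ snd _ _
      rw [whiskerLeft_snd, ← Category.assoc (snd _ _), this]
      exact (Category.id_comp _).symm
  refine ⟨k₀, ⟨(slice_unit_iterationPreserving_iff E E' k₀).1 hk₁, ?_⟩, ?_⟩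
  · have := congrArg (fun m => lift (toUnit X) (𝟙 X) ≫ m.left ≫ snd _ _) hk₂
    change lift _ _ ≫ (𝟙_ C ◁ η ≫ 𝟙_ C ◁ k₀) ≫ snd _ _ = lift _ _ ≫ 𝟙_ C ◁ f ≫ snd _ _ at this
    rwa [Category.assoc, whiskerLeft_snd, whiskerLeft_snd_assoc, whiskerLeft_snd, lift_snd_assoc,
      lift_snd_assoc, Category.id_comp, Category.id_comp] at this
  · rintro l ⟨hl₁, hl₂⟩
    have := hk₃ (Over.homMk (𝟙_ C ◁ l))
      ⟨(slice_unit_iterationPreserving_iff E E' l).2 hl₁, by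
        ext
        change 𝟙_ C ◁ η ≫ 𝟙_ C ◁ l = 𝟙_ C ◁ f
        rw [← MonoidalCategory.whiskerLeft_comp, hl₂]⟩
    replace this := congrArg (fun m => lift (toUnit A) (𝟙 A) ≫ m.left ≫ snd _ _) this
    change lift _ _ ≫ 𝟙_ C ◁ l ≫ snd _ _ = lift _ _ ≫ 𝟙_ C ◁ k₀ ≫ snd _ _ at this
    rwa [whiskerLeft_snd, whiskerLeft_snd, lift_snd_assoc, lift_snd_assoc, Category.id_comp,
      Category.id_comp] at this

end ElgotAlgebra

end OverSlice

/-! ### The quotient as a stable free Elgot algebra -/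

section StableFree

variable {C : Type u} [Category.{v} C] [CartesianMonoidalCategory C] [FinitaryExtensive C]
  [HasDelay C] {𝒩 : StableNNO C} [HasDelayQuotient 𝒩]
  (hp : ∀ X Y : C, PreservesColimit (parallelPair (iotaStar 𝒩 Y) (mapFst 𝒩 Y)) (tensorLeft X))
  {X : C} {α : D (Dtilde 𝒩 X) ⟶ Dtilde 𝒩 X} (hα : IsSearchAlgebra α)
  (hρ : IsDAlgebraMorphism (mult X) α (rho 𝒩 X))

include hp hρ

theorem elgotOfSearchAlgebra_isStableFree (hm : mult (Dtilde 𝒩 X) ≫ α = mapD α ≫ α) :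
    (elgotOfSearchAlgebra hα hm).IsStableFree (now X ≫ rho 𝒩 X) := by
  have key : ∀ Z : C, ((elgotOfSearchAlgebra hα hm).slice Z).IsFree
      (Over.homMk (Z ◁ (now X ≫ rho 𝒩 X)) :
        Over.mk (fst Z X) ⟶ Over.mk (fst Z (Dtilde 𝒩 X))) := by
    intro Z B E' f
    obtain ⟨h, ⟨h₁, h₂, h₃⟩, h₄⟩ := E'.toRel.existsUnique_extension hp hρ hα f.left (Over.w f)
    refine ⟨Over.homMk h h₁, ⟨?_, ?_⟩, ?_⟩
    · rw [ElgotAlgebra.slice_iterationPreserving_iff]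
      exact h₂
    · ext
      exact h₃
    · rintro l ⟨hl₁, hl₂⟩
      rw [ElgotAlgebra.slice_iterationPreserving_iff] at hl₁
      ext
      exact h₄ l.left ⟨Over.w l, hl₁, congrArg (fun m => m.left) hl₂⟩
  exact ⟨ElgotAlgebra.isFree_of_slice_unit _ _ (key _), key⟩

theorem exists_stableFree_of_searchAlgebra (hα : IsSearchAlgebra α) :
    ∃ E : ElgotAlgebra (Dtilde 𝒩 X),
      E.IsStableFree (now X ≫ rho 𝒩 X) ∧
      IsDAlgebraMorphism (mult X) (E.iter (out (Dtilde 𝒩 X))) (rho 𝒩 X) ∧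
      rho 𝒩 X = E.iter (out X ≫ coprod.map (now X ≫ rho 𝒩 X) (𝟙 (D X))) := by
  have hm := mult_comp_eq_mapD_comp hp hα hρ
  refine ⟨elgotOfSearchAlgebra hα hm, elgotOfSearchAlgebra_isStableFree hp hα hρ hm, ?_, ?_⟩
  · change IsDAlgebraMorphism _ (coit (out _) ≫ α) _
    rwa [coit_out_self, Category.id_comp]
  · change _ = coit _ ≫ α
    rw [← coit_mapD, coit_out_self, Category.id_comp, mapD_now_rho_comp hρ]

end StableFree

end

end DelayQuotient

open DelayQuotient in
theorem mainTheorem4 {C : Type u} [Category.{v} C] [CartesianMonoidalCategory C]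
    [FinitaryExtensive C] (𝒩 : StableNNO C) [(tensorRight 𝒩.N).IsLeftAdjoint] [HasDelay C]
    [HasDelayQuotient 𝒩]
    (preserved_by_products : ∀ X Y : C,
      PreservesColimit (parallelPair (iotaStar 𝒩 Y) (mapFst 𝒩 Y)) (tensorLeft X)) :
    List.TFAE [
      ∀ X : C, PreservesColimit (parallelPair (iotaStar 𝒩 X) (mapFst 𝒩 X)) (delayFunctor C),
      ∀ X : C, ∃ α : D (Dtilde 𝒩 X) ⟶ Dtilde 𝒩 X,
        IsSearchAlgebra α ∧ IsDAlgebraMorphism (mult X) α (rho 𝒩 X),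
      ∀ X : C, ∃ E : ElgotAlgebra (Dtilde 𝒩 X),
        E.IsStableFree (now X ≫ rho 𝒩 X) ∧
        IsDAlgebraMorphism (mult X) (E.iter (out (Dtilde 𝒩 X))) (rho 𝒩 X) ∧
        rho 𝒩 X = E.iter (out X ≫ coprod.map (now X ≫ rho 𝒩 X) (𝟙 (D X))),
      ∃ M : StrongMonadStr (dtildeFunctor 𝒩),
        IsStrongMonadMorphism (delayStrongMonad C) M (rhoNat 𝒩)] := by
  tfae_have 1 → 2 := fun h X => by
    have := h X
    exact exists_searchAlgebra_of_preserves 𝒩 X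
  tfae_have 2 → 1 := fun h X => by
    obtain ⟨α, hα, hρ⟩ := h X
    exact preservesColimit_delayFunctor preserved_by_products hα hρ
  tfae_have 2 → 3 := fun h X => by
    obtain ⟨α, hα, hρ⟩ := h X
    exact exists_stableFree_of_searchAlgebra preserved_by_products hρ hα
  tfae_have 3 → 2 := fun h X => by
    obtain ⟨E, -, hE, -⟩ := h X
    exact ⟨E.iter (out _), E.isSearchAlgebra_iter_out, hE⟩
  tfae_have 2 → 4 := fun h => by
    choose α hα hρ using h
    exact exists_strongMonad_of_searchAlgebra preserved_by_products hα hρ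
  tfae_have 4 → 2 := fun ⟨_, hM⟩ X => exists_searchAlgebra_of_strongMonad hM X
  tfae_finish
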